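/- **Setting.** A *compatibility scenario* $\Upsilon$ consists of a finite set $\mathcal M$ of measurements, a family $\mathcal C$ of subsets of $\mathcal M$ (maximal contexts), none properly contained in another, and a finite outcome set $\mathcal O^x$ for each $x\in\mathcal M$; write $\mathcal O^\gamma=\prod_{x\in\gamma}\mathcal O^x$. A *behavior* is a family $(p_\gamma)_{\gamma\in\mathcal C}$ of probability distributions on the sets $\mathcal O^\gamma$. It belongs to $\mathrm{ND}(\Upsilon)$ (nondisturbing) if any two $p_\gamma,p_{\gamma'}$ have the same marginal on $\gamma\cap\gamma'$, and to $\mathrm{NC}(\Upsilon)$ (noncontextual) if all $p_\gamma$ are marginals of one probability distribution on $\prod_{x\in\mathcal M}\mathcal O^x$. A *noncontextual wiring* $\mathcal W:\Upsilon\to\Upsilon'$ is given by the following data. (i) A noncontextual pre-processing behavior $(p_\beta(\mathbf r))$ on the measurements and contexts of $\Upsilon'$, with arbitrary finite outcome sets. (ii) A function assigning to each context $\beta$ of $\Upsilon'$ and each outcome $\mathbf r$ with $p_\beta(\mathbf r)>0$ a context $\gamma=f(\mathbf r)$ of $\Upsilon$, together with, for each measurement $x$ of $\Upsilon'$ and each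 outcome $r_x$, a measurement $\gamma_x$ of $\Upsilon$ depending only on $(x,r_x)$, such that $\gamma_x\in f(\mathbf r)$ for all $x\in\beta$. (iii) A noncontextual post-processing behavior $(p_\delta)$ on a scenario whose measurements are labelled by the measurements $x$ of $\Upsilon'$, those labelled $x$ having outcome set $\mathcal O'^x$. (iv) Functions $g_x$ choosing a measurement labelled $x$ from $r_x$ and the outcome $s_{\gamma_x}$, such that $\delta=g(\mathbf s|\mathbf r,\beta):=\{g_x(s_{\gamma_x}|r_x):x\in\beta\}$ is always a context of the post-processing scenario. It acts on behaviors of $\Upsilon$ by $$\mathcal W(B)_\beta(\mathbf t)=\sum_{\mathbf r}\sum_{\mathbf s\in\mathcal O^{f(\mathbf r)}}p_\beta(\mathbf r)\,p_{f(\mathbf r)}(\mathbf s)\,p_{\delta=g(\mathbf s|\mathbf r,\beta)}(\mathbf t),$$ where the sum is over $\mathbf r$ with $p_\beta(\mathbf r)>0$. For nondisturbing behaviors $B,B'$ (in possibly different scenarios) write $B\to B'$ if $\mathcal W(B)=B'$ for some noncontextual wiring $\mathcal W$, and call $B,B'$ *incomparable*, $B\nleftrightarrow B'$, if neither $B\to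 B'$ nor $B'\to B$. The relation is *weak* if, for all pairwise distinct $A,B,C$, $A\nleftrightarrow B$ and $B\nleftrightarrow C$ imply $A\nleftrightarrow C$. For $n\ge3$ the $n$-cycle scenario $\Upsilon_n$ has measurements $x_i$ ($i\in\mathbb Z/n$) with outcomes in $\{0,1\}$ and maximal contexts $\{x_i,x_{i+1}\}$. Put $\langle x_ix_{i+1}\rangle=p(00)+p(11)-p(10)-p(01)$ and, for signs $a\in\{1,-1\}^{\mathbb Z/n}$ with an odd number of $-1$'s, $I_a(B)=\sum_i a_i\langle x_ix_{i+1}\rangle$. **Theorem.** The relation $\to$ on all nondisturbing behaviors is not weak: there are pairwise distinct $B_1,B_2,B_3$ with $B_1\nleftrightarrow B_2$ and $B_2\nleftrightarrow B_3$, while $B_1$ and $B_3$ are comparable. More precisely, let $n\ge3$ and let $a$ be as above. There is a unique $B_a\in\mathrm{ext}(\mathrm{ND}(\Upsilon_n))\setminus\mathrm{ext}(\mathrm{NC}(\Upsilon_n))$ with $I_a(B_a)=n$, and there exists $\tilde B\in\mathrm{ext}(\mathrm{NC}(\Upsilon_n))$ with $I_a(\tilde B)=n-2$. For every such $\tilde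 B$ put $$B_\varepsilon=\varepsilon B_a+(1-\varepsilon)\Big(\tfrac{n-2}{n}B_a+\tfrac2nB_\varnothing\Big),\qquad B(\alpha,\varepsilon)=\alpha\tilde B+(1-\alpha)B_\varepsilon,$$ where $B_\varnothing$ is the behavior with all joint outcomes of a context equally likely. Then $B_1=B(\tfrac14,\tfrac14)$, $B_2=B(\tfrac34,\tfrac12)$ and $B_3=B(\tfrac18,\tfrac14)$ are pairwise distinct nondisturbing behaviors such that $B_1\nleftrightarrow B_2$, $B_2\nleftrightarrow B_3$ and $B_3\to B_1$. -/

import Mathlib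

open scoped BigOperators

noncomputable section

/-! ### Compatibility scenarios and behaviors -/

/-- A compatibility scenario: a finite set `M` of measurements, a family of maximal contexts none
of which properly contains another, and a finite set `O x` of outcomes for every measurement. -/
structure Scenario where
  M : Type
  [fintypeM : Fintype M]
  [decEqM : DecidableEq M]
  contexts : Set (Finset M)
  antichain : ∀ γ ∈ contexts, ∀ γ' ∈ contexts, γ ⊆ γ' → γ = γ'
  O : M → Type
  [fintypeO : ∀ x, Fintype (O x)]
  [decEqO : ∀ x, DecidableEq (O x)]

attribute [instance] Scenario.fintypeM Scenario.decEqM Scenario.fintypeO Scenario.decEqO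

namespace Scenario

/-- Joint outcomes of the measurements in `γ`. -/
abbrev Outcome (Υ : Scenario) (γ : Finset Υ.M) : Type := ∀ x : {x // x ∈ γ}, Υ.O x.1

/-- Real-valued data tables on `Υ`: the real vector space in which the behaviors live. -/
abbrev Table (Υ : Scenario) : Type := ∀ γ : Υ.contexts, Υ.Outcome γ.1 → ℝ

/-- Behaviors: one probability distribution on joint outcomes for every maximal context. -/
def behaviors (Υ : Scenario) : Set Υ.Table :=
  {p | ∀ γ, (∀ s, 0 ≤ p γ s) ∧ ∑ s, p γ s = 1}

/-- Restriction of a joint outcome to fewer measurements. -/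
def restrict (Υ : Scenario) {S γ : Finset Υ.M} (h : S ⊆ γ) (s : Υ.Outcome γ) : Υ.Outcome S :=
  fun x => s ⟨x.1, h x.2⟩

/-- The marginal of a distribution on the outcomes of `γ` on a subset `S` of `γ`. -/
def marginal (Υ : Scenario) {S γ : Finset Υ.M} (h : S ⊆ γ) (q : Υ.Outcome γ → ℝ)
    (u : Υ.Outcome S) : ℝ :=
  ∑ s : Υ.Outcome γ, if Υ.restrict h s = u then q s else 0

/-- The no-disturbance set: the marginals on the intersection of any two contexts agree. -/
def ND (Υ : Scenario) : Set Υ.Table :=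
  {p | p ∈ Υ.behaviors ∧ ∀ (γ γ' : Υ.contexts) (u : Υ.Outcome (γ.1 ∩ γ'.1)),
    Υ.marginal Finset.inter_subset_left (p γ) u = Υ.marginal Finset.inter_subset_right (p γ') u}

/-- The noncontextual set: there is a probability distribution on the joint outcomes of all the
measurements whose marginals on the maximal contexts give the behavior. -/
def NC (Υ : Scenario) : Set Υ.Table :=
  {p | p ∈ Υ.behaviors ∧ ∃ P : (∀ x, Υ.O x) → ℝ, (∀ t, 0 ≤ P t) ∧ ∑ t, P t = 1 ∧
    ∀ (γ : Υ.contexts) (s : Υ.Outcome γ.1),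
      p γ s = ∑ t : (∀ x, Υ.O x), if (fun x : {x // x ∈ γ.1} => t x.1) = s then P t else 0}

/-- The same measurements and contexts with other outcome sets. -/
abbrev withOutcomes (Υ : Scenario) (R : Υ.M → Type) [∀ x, Fintype (R x)]
    [∀ x, DecidableEq (R x)] : Scenario where
  M := Υ.M
  contexts := Υ.contexts
  antichain := Υ.antichain
  O := R

/-- A scenario whose measurements are pairs `⟨x, ν⟩` with `ν : N x`, where `⟨x, ν⟩` has the
outcomes of the measurement `x` of `Υ`. -/
abbrev postScenario (Υ : Scenario) (N : Υ.M → Type) [∀ x, Fintype (N x)] [∀ x, DecidableEq (N x)]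
    (C : Set (Finset (Σ x, N x))) (hC : ∀ γ ∈ C, ∀ γ' ∈ C, γ ⊆ γ' → γ = γ') : Scenario where
  M := Σ x, N x
  contexts := C
  antichain := hC
  O := fun d => Υ.O d.1

end Scenario

/-! ### Noncontextual wirings -/

/-- A noncontextual wiring from `Υ` to `Υ'`.

The measurements and contexts of `Υ'` are those of the pre-processing box `pre`, with outcomes
`R x`. When the context `β` of `Υ'` is chosen, `pre` returns a joint outcome `r`, which selects a
context `f r` of the given box; the outcome `r x` obtained at `x ∈ β` is associated with the
measurement `port x (r x)` of that context. The outcome of this measurement, together with the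
side information `x` and `r x`, selects a measurement of the post-processing box through `g x`.
The measurements of the post-processing scenario are `⟨x, ν⟩`, `ν : N x`: those available at `x`,
where `N x` may be a disjoint union over the values of `r x`. Its outcome is the final one at `x`.
Since `post` is one noncontextual box on this whole scenario, its outcomes factorize given a hidden
variable whose distribution does not depend on `β`, `r` or `s`, even though the measurements
are chosen adaptively. -/
structure Wiring (Υ Υ' : Scenario) where
  R : Υ'.M → Type
  [fintypeR : ∀ x, Fintype (R x)]
  [decEqR : ∀ x, DecidableEq (R x)]
  pre : (Υ'.withOutcomes R).Table
  pre_mem : pre ∈ (Υ'.withOutcomes R).NC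
  f : ∀ β : Υ'.contexts, {r : (Υ'.withOutcomes R).Outcome β.1 // 0 < pre β r} → Υ.contexts
  port : ∀ x, R x → Υ.M
  port_mem : ∀ β r (x : {x // x ∈ β.1}), port x.1 (r.1 x) ∈ (f β r).1
  N : Υ'.M → Type
  [fintypeN : ∀ x, Fintype (N x)]
  [decEqN : ∀ x, DecidableEq (N x)]
  postContexts : Set (Finset (Σ x, N x))
  postAntichain : ∀ γ ∈ postContexts, ∀ γ' ∈ postContexts, γ ⊆ γ' → γ = γ'
  post : (Υ'.postScenario N postContexts postAntichain).Table
  post_mem : post ∈ (Υ'.postScenario N postContexts postAntichain).NC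
  g : ∀ x (ρ : R x), Υ.O (port x ρ) → N x
  g_mem : ∀ β r (s : Υ.Outcome (f β r).1),
    (Finset.univ.image fun x : {x // x ∈ β.1} =>
      (⟨x.1, g x.1 (r.1 x) (s ⟨_, port_mem β r x⟩)⟩ : Σ x, N x)) ∈ postContexts

attribute [instance] Wiring.fintypeR Wiring.decEqR Wiring.fintypeN Wiring.decEqN

namespace Wiring

variable {Υ Υ' : Scenario}

/-- The context `g(s | r, β)`, the union of the local choices. -/
def postContext (W : Wiring Υ Υ') (β : Υ'.contexts)
    (r : {r : (Υ'.withOutcomes W.R).Outcome β.1 // 0 < W.pre β r})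
    (s : Υ.Outcome (W.f β r).1) : W.postContexts :=
  ⟨_, W.g_mem β r s⟩

theorem fst_mem_of_mem_postContext (W : Wiring Υ Υ') (β : Υ'.contexts)
    (r : {r : (Υ'.withOutcomes W.R).Outcome β.1 // 0 < W.pre β r})
    (s : Υ.Outcome (W.f β r).1) {d : Σ x, W.N x} (hd : d ∈ (W.postContext β r s).1) :
    d.1 ∈ β.1 := by
  obtain ⟨x, -, rfl⟩ := Finset.mem_image.1 hd
  exact x.2

/-- The action of a wiring:
`p_β(t) = ∑_{r,s} p_β(r) p_{γ = f(r)}(s) p_{δ = g(s | r, β)}(t)`. -/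
def apply (W : Wiring Υ Υ') (B : Υ.Table) : Υ'.Table := fun β t =>
  ∑ r : {r : (Υ'.withOutcomes W.R).Outcome β.1 // 0 < W.pre β r},
    ∑ s : Υ.Outcome (W.f β r).1,
      W.pre β r.1 * B (W.f β r) s *
        W.post (W.postContext β r s)
          (fun d => t ⟨d.1.1, W.fst_mem_of_mem_postContext β r s d.2⟩)

end Wiring

/-! ### The order on objects -/

/-- The objects of the resource theory: nondisturbing behaviors in arbitrary scenarios. -/
abbrev Obj : Type 1 := Σ Υ : Scenario, Υ.ND

/-- `A → B` under noncontextual wirings. -/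
def NCWConverts (A B : Obj) : Prop :=
  ∃ W : Wiring A.1 B.1, W.apply (A.2 : A.1.Table) = (B.2 : B.1.Table)

/-- `A` and `B` are incomparable under the relation `rel`. -/
def Incomparable {U : Type*} (rel : U → U → Prop) (A B : U) : Prop := ¬ rel A B ∧ ¬ rel B A

/-- The relation is weak: incomparability is transitive on triples of distinct objects. -/
def IsWeak {U : Type*} (rel : U → U → Prop) : Prop :=
  ∀ A B C : U, A ≠ B → B ≠ C → A ≠ C →
    Incomparable rel A B → Incomparable rel B C → Incomparable rel A C

/-! ### The n-cycle scenarios -/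

/-- The `n`-cycle scenario: `n` dichotomic measurements, maximal contexts `{x_i, x_{i+1}}` with
indices modulo `n`. -/
def cycleScenario (n : ℕ) [NeZero n] : Scenario where
  M := ZMod n
  contexts := Set.range fun i : ZMod n => ({i, i + 1} : Finset (ZMod n))
  antichain := by
    rintro _ ⟨i, rfl⟩ _ ⟨j, rfl⟩ h
    refine Finset.eq_of_subset_of_card_le h ?_
    have key : ∀ k : ZMod n, ({k, k + 1} : Finset (ZMod n)).card =
        ({0, 1} : Finset (ZMod n)).card := by
      intro k
      have : ({k, k + 1} : Finset (ZMod n)) = ({0, 1} : Finset (ZMod n)).image (k + ·) := by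
        simp [Finset.image_insert]
      rw [this, Finset.card_image_of_injective _ (add_right_injective k)]
    simp only [key, le_refl]
  O := fun _ => Bool

section Cycle

variable {n : ℕ} [NeZero n]

/-- The context `{x_i, x_{i+1}}`. -/
def edge (i : ZMod n) : (cycleScenario n).contexts := ⟨({i, i + 1} : Finset (ZMod n)), i, rfl⟩

/-- The outcomes of the two measurements `x_i` and `x_{i+1}` coincide. -/
def Agree (i : ZMod n) (s : (cycleScenario n).Outcome (edge i).1) : Prop :=
  (s ⟨i, Finset.mem_insert_self i {i + 1}⟩ : Bool) =
    s ⟨i + 1, Finset.mem_insert_of_mem (Finset.mem_singleton_self (i + 1))⟩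

open Classical in
/-- The two-point correlation `⟨x_i x_{i+1}⟩ = p(00) + p(11) - p(10) - p(01)`. -/
def corr (B : (cycleScenario n).Table) (i : ZMod n) : ℝ :=
  ∑ s : (cycleScenario n).Outcome (edge i).1, if Agree i s then B (edge i) s else -B (edge i) s

/-- Sign choices `a_i ∈ {1, -1}` with an odd number of `-1`, which label the facet inequalities. -/
def OddSigns (a : ZMod n → ℤ) : Prop :=
  (∀ i, a i = 1 ∨ a i = -1) ∧ Odd (Finset.univ.filter fun i => a i = -1).card

/-- The functional `∑ a_i ⟨x_i x_{i+1}⟩`, bounded by `n - 2` on noncontextual behaviors. -/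
def cycleFunctional (a : ZMod n → ℤ) (B : (cycleScenario n).Table) : ℝ :=
  ∑ i, (a i : ℝ) * corr B i

variable (n) in
/-- The nondisturbing contextual vertices. -/
def NDC : Set (cycleScenario n).Table :=
  Set.extremePoints ℝ (cycleScenario n).ND \ Set.extremePoints ℝ (cycleScenario n).NC

/-- The noncontextual vertices that saturate the inequality labelled by `a`. -/
def saturatingVertices (a : ZMod n → ℤ) : Set (cycleScenario n).Table :=
  {B | B ∈ Set.extremePoints ℝ (cycleScenario n).NC ∧ cycleFunctional a B = n - 2}

variable (n) in
/-- The behavior in which all joint outcomes of a context are equally likely. -/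
def uniformBehavior : (cycleScenario n).Table :=
  fun γ _ => 1 / (Fintype.card ((cycleScenario n).Outcome γ.1) : ℝ)

/-- `B_ε = ε B_k + (1 - ε) B_k'` with `B_k' = ((n - 2) / n) B_k + (2 / n) B_∅`, on the segment from
the facet to the contextual vertex `Bk`. -/
def segmentBehavior (Bk : (cycleScenario n).Table) (ε : ℝ) : (cycleScenario n).Table :=
  ε • Bk + (1 - ε) • ((((n : ℝ) - 2) / n) • Bk + ((2 : ℝ) / n) • uniformBehavior n)

/-- `B(α, ε) = α B̃ + (1 - α) B_ε`. -/
def familyBehavior (Bk Bt : (cycleScenario n).Table) (α ε : ℝ) : (cycleScenario n).Table :=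
  α • Bt + (1 - α) • segmentBehavior Bk ε

end Cycle

end

/-!
The noncontextual behaviors are the mixtures of the deterministic ones, and on a deterministic
behavior with outcomes of signs `σ_i` some term `a_i σ_i σ_{i+1}` is `-1`, because the product of
all terms is `∏ a_i = -1`. Hence `I_a ≤ n - 2` on noncontextual behaviors.
A nondisturbing `B` with `I_a(B) = n` has perfect correlations; the mean values of the
measurements then pick up the factor `∏ a_i = -1` around the cycle and vanish, which leaves
the single behavior `signBox a` (`eq_signBox`). It is the only point of a face of `ND`, thus a
vertex.

Conditioned on the hidden variables of its two noncontextual boxes, a wiring is deterministic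
(`Wiring.apply_mem_convexHull`), so bounds by affine functionals need only be checked for
deterministic wirings of the cycle. If such a wiring ignores the outcome of some measurement `x_k`,
it cannot see the sign of the correlation on one edge at `x_k`; changing that sign where necessary
replaces `signBox c` by a noncontextual behavior, so the image of any member of the family has
`I_a ≤ n - 2`. Otherwise the wiring permutes the measurements and their outcomes: it fixes the
uniform behavior, and `I_a` of the image is at most `n - 2 + 2 (1 - α) ε`, the value at `B(α, ε)`
(`detWiring_apply_familyBehavior`). There are two consequences.

* `I_a` cannot grow beyond `n - 2 + 2 (1 - α) ε` (`cycleFunctional_wiring_le`), so `B₂` is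
  converted neither to `B₁` nor to `B₃`.
* The violation of the inequality is bounded by `4 n ε / (1 - ε)` times the probability of any joint
  outcome, since the uniform part survives in proportion (`violation_le_of_wiring`). For a target
  `B(α', ε')` there is a joint outcome excluded both by `signBox a` and by the deterministic `B̃`
  (`exists_familyBehavior_edge_eq`), for which the bound reads `ε' (1 - ε) ≤ ε (1 - ε')`, that is
  `ε' ≤ ε`. So neither `B₁` nor `B₃`, with `ε = 1/4`, is converted to `B₂`, with `ε' = 1/2`.

Finally `B₁` is a mixture of `B₃` and the deterministic `B̃`, which a wiring with a shared random bit
produces (`NCWConverts.mix_deterministic`).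
-/

open scoped BigOperators

noncomputable section

/-! ### Deterministic behaviors and the noncontextual polytope -/

namespace Scenario

variable {Υ : Scenario}

/-- The deterministic behavior in which every measurement `x` has the outcome `t x`. -/
def deterministic (t : ∀ x, Υ.O x) : Υ.Table :=
  fun γ s => if (fun x : {x // x ∈ γ.1} => t x.1) = s then 1 else 0

theorem convex_behaviors : Convex ℝ Υ.behaviors := by
  intro p hp q hq a b ha hb hab γ
  refine ⟨fun s => ?_, ?_⟩
  · have h1 := (hp γ).1 s
    have h2 := (hq γ).1 s
    simp only [Pi.add_apply, Pi.smul_apply, smul_eq_mul]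
    positivity
  · simp only [Pi.add_apply, Pi.smul_apply, smul_eq_mul]
    rw [Finset.sum_add_distrib, ← Finset.mul_sum, ← Finset.mul_sum, (hp γ).2, (hq γ).2]
    linarith

theorem marginal_combination {S γ : Finset Υ.M} (h : S ⊆ γ) (p q : Υ.Outcome γ → ℝ) (a b : ℝ)
    (u : Υ.Outcome S) :
    Υ.marginal h (a • p + b • q) u = a * Υ.marginal h p u + b * Υ.marginal h q u := by
  simp only [marginal, Finset.mul_sum, ← Finset.sum_add_distrib, Pi.add_apply, Pi.smul_apply,
    smul_eq_mul]
  refine Finset.sum_congr rfl fun s _ => ?_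
  split_ifs <;> ring

theorem convex_ND : Convex ℝ Υ.ND := by
  intro p hp q hq a b ha hb hab
  refine ⟨convex_behaviors hp.1 hq.1 ha hb hab, fun γ γ' u => ?_⟩
  have e : ∀ γ, (a • p + b • q) γ = a • p γ + b • q γ := fun _ => rfl
  rw [e, e, marginal_combination, marginal_combination, hp.2, hq.2]

theorem deterministic_mem_behaviors (t : ∀ x, Υ.O x) : deterministic t ∈ Υ.behaviors := by
  refine fun γ => ⟨fun s => ?_, ?_⟩
  · unfold deterministic; split_ifs <;> norm_num
  · simp [deterministic]

theorem deterministic_mem_NC (t : ∀ x, Υ.O x) : deterministic t ∈ Υ.NC := by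
  refine ⟨deterministic_mem_behaviors t, fun t' => if t = t' then 1 else 0, fun t' => ?_, ?_,
    fun γ s => ?_⟩
  · dsimp only; split_ifs <;> norm_num
  · simp
  · rw [Finset.sum_eq_single t]
    · simp [deterministic]
    · intro t' _ h
      simp [Ne.symm h]
    · simp

theorem marginal_deterministic (t : ∀ x, Υ.O x) (γ : Υ.contexts) {S : Finset Υ.M} (h : S ⊆ γ.1)
    (u : Υ.Outcome S) :
    Υ.marginal h (deterministic t γ) u =
      if (fun x : {x // x ∈ S} => t x.1) = u then 1 else 0 := by
  unfold marginal
  rw [Finset.sum_eq_single (fun x : {x // x ∈ γ.1} => t x.1)]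
  · simp only [deterministic, if_true]
    rfl
  · intro s _ hs
    simp [deterministic, Ne.symm hs]
  · simp

theorem deterministic_mem_ND (t : ∀ x, Υ.O x) : deterministic t ∈ Υ.ND :=
  ⟨deterministic_mem_behaviors t, fun γ γ' u => by
    rw [marginal_deterministic, marginal_deterministic]⟩

theorem convex_NC : Convex ℝ Υ.NC := by
  rintro p ⟨hp, P, hP, hP1, hpP⟩ q ⟨hq, Q, hQ, hQ1, hqQ⟩ a b ha hb hab
  refine ⟨convex_behaviors hp hq ha hb hab, a • P + b • Q, fun t => ?_, ?_, fun γ s => ?_⟩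
  · have h1 := hP t
    have h2 := hQ t
    simp only [Pi.add_apply, Pi.smul_apply, smul_eq_mul]
    positivity
  · simp only [Pi.add_apply, Pi.smul_apply, smul_eq_mul]
    rw [Finset.sum_add_distrib, ← Finset.mul_sum, ← Finset.mul_sum, hP1, hQ1]
    linarith
  · simp only [Pi.add_apply, Pi.smul_apply, smul_eq_mul, hpP, hqQ, Finset.mul_sum,
      ← Finset.sum_add_distrib]
    refine Finset.sum_congr rfl fun t _ => ?_
    split_ifs <;> ring

theorem NC_eq_convexHull : Υ.NC = convexHull ℝ (Set.range (deterministic (Υ := Υ))) := by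
  refine Set.Subset.antisymm ?_ (convexHull_min ?_ convex_NC)
  · rintro p ⟨-, P, hP, hP1, hpP⟩
    have e : p = ∑ t, P t • deterministic t := by
      funext γ s
      rw [hpP, Finset.sum_apply, Finset.sum_apply]
      simp [deterministic]
    rw [e]
    exact (convex_convexHull ℝ _).sum_mem (fun t _ => hP t) hP1
      fun t _ => subset_convexHull ℝ _ ⟨t, rfl⟩
  · rintro _ ⟨t, rfl⟩
    exact deterministic_mem_NC t

theorem NC_subset_ND : Υ.NC ⊆ Υ.ND := by
  rw [NC_eq_convexHull]
  refine convexHull_min ?_ convex_ND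
  rintro _ ⟨t, rfl⟩
  exact deterministic_mem_ND t

theorem extremePoints_NC_subset :
    Set.extremePoints ℝ Υ.NC ⊆ Set.range (deterministic (Υ := Υ)) := by
  rw [NC_eq_convexHull]
  exact extremePoints_convexHull_subset

/-- A probability `0` is also `0` in both parts of a decomposition, and a deterministic table is
determined by its zeros and normalization. -/
theorem deterministic_mem_extremePoints_NC (t : ∀ x, Υ.O x) :
    deterministic t ∈ Set.extremePoints ℝ Υ.NC := by
  rw [mem_extremePoints_iff_left]
  refine ⟨deterministic_mem_NC t, ?_⟩
  rintro p hp q hq ⟨a, b, ha, hb, hab, h⟩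
  funext γ
  have h0 : ∀ s, s ≠ (fun x : {x // x ∈ γ.1} => t x.1) → p γ s = 0 := by
    intro s hs
    have h1 := congrFun (congrFun h γ) s
    have h2 := (hp.1 γ).1 s
    have h3 := (hq.1 γ).1 s
    simp only [Pi.add_apply, Pi.smul_apply, smul_eq_mul, deterministic, if_neg (Ne.symm hs)] at h1
    nlinarith [mul_nonneg ha.le h2, mul_nonneg hb.le h3]
  funext s
  by_cases hs : s = (fun x : {x // x ∈ γ.1} => t x.1)
  · subst hs
    have h1 := (hp.1 γ).2
    rw [Finset.sum_eq_single (fun x : {x // x ∈ γ.1} => t x.1) (fun s _ hs => h0 s hs)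
      (by simp)] at h1
    simp [deterministic, h1]
  · rw [h0 s hs]
    simp [deterministic, Ne.symm hs]

/-- In a nondisturbing behavior the distribution of a single measurement does not depend on the
context in which it is performed. -/
theorem ND.expectation_eq {p : Υ.Table} (hp : p ∈ Υ.ND) (γ γ' : Υ.contexts) (x : Υ.M)
    (hx : x ∈ γ.1) (hx' : x ∈ γ'.1) (F : Υ.O x → ℝ) :
    ∑ s, F (s ⟨x, hx⟩) * p γ s = ∑ s, F (s ⟨x, hx'⟩) * p γ' s := by
  have key : ∀ (δ : Υ.contexts) (S : Finset Υ.M) (h : S ⊆ δ.1) (hS : x ∈ S),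
      ∑ s, F (s ⟨x, h hS⟩) * p δ s = ∑ u, F (u ⟨x, hS⟩) * Υ.marginal h (p δ) u := by
    intro δ S h hS
    simp only [marginal, Finset.mul_sum]
    rw [Finset.sum_comm]
    refine Finset.sum_congr rfl fun s _ => ?_
    rw [Finset.sum_eq_single (Υ.restrict h s)]
    · simp [restrict]
    · intro u _ hu
      simp [Ne.symm hu]
    · simp
  have hS : x ∈ γ.1 ∩ γ'.1 := Finset.mem_inter.2 ⟨hx, hx'⟩
  rw [key γ _ Finset.inter_subset_left hS, key γ' _ Finset.inter_subset_right hS]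
  simp only [hp.2]

end Scenario

/-! ### Deterministic wirings -/

/-- A deterministic wiring: the measurement `x` of `Υ'` is simulated by performing the measurement
`port x` of `Υ` and processing its outcome by the function `out x`; the measurements of a context
`β` of `Υ'` are performed in the context `ctx β` of `Υ`. -/
structure DetWiring (Υ Υ' : Scenario) where
  port : Υ'.M → Υ.M
  ctx : Υ'.contexts → Υ.contexts
  port_mem : ∀ β x, x ∈ β.1 → port x ∈ (ctx β).1
  out : ∀ x, Υ.O (port x) → Υ'.O x

namespace DetWiring

variable {Υ Υ' : Scenario} (D : DetWiring Υ Υ')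

/-- The joint outcome in the context `β` that results from the joint outcome `s` in `ctx β`. -/
def outcome (β : Υ'.contexts) (s : Υ.Outcome (D.ctx β).1) : Υ'.Outcome β.1 :=
  fun x => D.out x.1 (s ⟨D.port x.1, D.port_mem β x.1 x.2⟩)

/-- The action of a deterministic wiring: the push-forward along `outcome`. -/
def apply : Υ.Table →ₗ[ℝ] Υ'.Table where
  toFun B β t := ∑ s, if D.outcome β s = t then B (D.ctx β) s else 0
  map_add' A B := by
    funext β t
    simp only [Pi.add_apply, ← Finset.sum_add_distrib]
    refine Finset.sum_congr rfl fun s _ => ?_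
    split_ifs <;> simp
  map_smul' c B := by
    funext β t
    simp only [Pi.smul_apply, smul_eq_mul, Finset.mul_sum, RingHom.id_apply]
    refine Finset.sum_congr rfl fun s _ => ?_
    split_ifs <;> simp

theorem apply_apply (B : Υ.Table) (β : Υ'.contexts) (t : Υ'.Outcome β.1) :
    D.apply B β t = ∑ s, if D.outcome β s = t then B (D.ctx β) s else 0 := rfl

theorem apply_mem_behaviors {B : Υ.Table} (hB : B ∈ Υ.behaviors) : D.apply B ∈ Υ'.behaviors := by
  refine fun β => ⟨fun t => Finset.sum_nonneg fun s _ => ?_, ?_⟩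
  · split_ifs
    exacts [(hB _).1 s, le_rfl]
  · simp only [apply_apply]
    rw [Finset.sum_comm]
    simp [(hB _).2]

theorem apply_deterministic (t : ∀ x, Υ.O x) :
    D.apply (Scenario.deterministic t) =
      Scenario.deterministic fun x => D.out x (t (D.port x)) := by
  funext β u
  rw [apply_apply, Finset.sum_eq_single (fun x : {x // x ∈ (D.ctx β).1} => t x.1)]
  · simp only [Scenario.deterministic, if_true]
    rfl
  · intro s _ hs
    simp [Scenario.deterministic, Ne.symm hs]
  · simp

theorem apply_mem_NC {B : Υ.Table} (hB : B ∈ Υ.NC) : D.apply B ∈ Υ'.NC := by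
  rw [Scenario.NC_eq_convexHull] at hB ⊢
  have h := Set.mem_image_of_mem D.apply hB
  rw [D.apply.image_convexHull] at h
  refine convexHull_mono ?_ h
  rintro _ ⟨_, ⟨t, rfl⟩, rfl⟩
  exact ⟨_, (D.apply_deterministic t).symm⟩

end DetWiring

/-- Conditioned on the hidden variables `ρ` and `τ` of the two noncontextual boxes, a wiring is
deterministic: the port of `x` is determined by `ρ x` alone, and its output by `τ` and the outcome
at that port. Averaging over the hidden variables gives a convex combination. -/
theorem Wiring.apply_mem_convexHull {Υ Υ' : Scenario} (W : Wiring Υ Υ') (B : Υ.Table) :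
    W.apply B ∈ convexHull ℝ (Set.range fun D : DetWiring Υ Υ' => D.apply B) := by
  obtain ⟨-, P, hP, hP1, hpre⟩ := W.pre_mem
  obtain ⟨-, Q, hQ, hQ1, hpost⟩ := W.post_mem
  -- `W.f` is defined only on outcomes of positive probability, so `ρ` ranges over the hidden
  -- variables of positive weight.
  have hpos : ∀ (ρ : {ρ // 0 < P ρ}) (β : Υ'.contexts),
      0 < W.pre β (fun x : {x // x ∈ β.1} => ρ.1 x.1) := by
    intro ρ β
    refine ρ.2.trans_le ?_
    have h := Finset.single_le_sum
      (f := fun t => if (fun x : {x // x ∈ β.1} => t x.1) =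
        (fun x : {x // x ∈ β.1} => ρ.1 x.1) then P t else 0)
      (fun t _ => by dsimp only; split_ifs; exacts [hP t, le_rfl]) (Finset.mem_univ ρ.1)
    rw [hpre]
    simpa using h
  let r : ∀ (ρ : {ρ // 0 < P ρ}) (β : Υ'.contexts),
      {r : (Υ'.withOutcomes W.R).Outcome β.1 // 0 < W.pre β r} := fun ρ β => ⟨_, hpos ρ β⟩
  let D : {ρ // 0 < P ρ} → (∀ d : Σ x, W.N x, Υ'.O d.1) → DetWiring Υ Υ' := fun ρ τ =>
    { port := fun x => W.port x (ρ.1 x)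
      ctx := fun β => W.f β (r ρ β)
      port_mem := fun β x hx => W.port_mem β (r ρ β) ⟨x, hx⟩
      out := fun x o => τ ⟨x, W.g x (ρ.1 x) o⟩ }
  have hsub : ∀ F : (∀ x, W.R x) → ℝ, (∀ ρ, P ρ = 0 → F ρ = 0) →
      ∑ ρ : {ρ // 0 < P ρ}, F ρ.1 = ∑ ρ, F ρ := fun F hF =>
    (Finset.sum_subtype (Finset.univ.filter fun ρ => 0 < P ρ) (by simp) F).symm.trans
      (Finset.sum_filter_of_ne fun ρ _ h => (hP ρ).lt_of_ne fun h0 => h (hF ρ h0.symm))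
  have hsum : ∑ ρ : {ρ // 0 < P ρ}, P ρ.1 = 1 := (hsub P fun _ h => h).trans hP1
  have e : W.apply B =
      ∑ i : {ρ // 0 < P ρ} × (∀ d : Σ x, W.N x, Υ'.O d.1),
        (P i.1.1 * Q i.2) • (D i.1 i.2).apply B := by
    funext β t
    have hr : ∀ q : {r : (Υ'.withOutcomes W.R).Outcome β.1 // 0 < W.pre β r},
        W.pre β q.1 = ∑ ρ : {ρ // 0 < P ρ}, if r ρ β = q then P ρ.1 else 0 := by
      intro q
      rw [hpre, ← hsub _ fun ρ h => by rw [h, ite_self]]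
      simp only [r, Subtype.ext_iff]
    -- the contribution of the outcome `q` of the first box
    let G : {r : (Υ'.withOutcomes W.R).Outcome β.1 // 0 < W.pre β r} → ℝ := fun q =>
      ∑ s : Υ.Outcome (W.f β q).1, B (W.f β q) s * W.post (W.postContext β q s)
          (fun d => t ⟨d.1.1, W.fst_mem_of_mem_postContext β q s d.2⟩)
    have h1 : W.apply B β t = ∑ ρ : {ρ // 0 < P ρ}, P ρ.1 * G (r ρ β) := by
      have h2 : W.apply B β t = ∑ q, W.pre β q.1 * G q := by
        simp only [Wiring.apply, G, Finset.mul_sum, mul_assoc]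
      rw [h2]
      simp only [hr, Finset.sum_mul]
      rw [Finset.sum_comm]
      refine Finset.sum_congr rfl fun ρ _ => ?_
      simp [ite_mul]
    rw [h1, Fintype.sum_prod_type, Finset.sum_apply, Finset.sum_apply]
    refine Finset.sum_congr rfl fun ρ _ => ?_
    simp only [Finset.sum_apply, Pi.smul_apply, smul_eq_mul, mul_assoc, ← Finset.mul_sum]
    congr 1
    simp only [G, hpost, DetWiring.apply_apply, Finset.mul_sum]
    rw [Finset.sum_comm]
    refine Finset.sum_congr rfl fun τ _ => Finset.sum_congr rfl fun s _ => ?_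
    have hiff : ((fun d : {d // d ∈ (W.postContext β (r ρ β) s).1} => τ d.1) =
        fun d : {d // d ∈ (W.postContext β (r ρ β) s).1} =>
          t ⟨d.1.1, W.fst_mem_of_mem_postContext β (r ρ β) s d.2⟩) ↔
        (D ρ τ).outcome β s = t := by
      constructor
      · intro h
        funext x
        exact congrFun h ⟨⟨x.1, W.g x.1 (ρ.1 x.1) (s ⟨_, W.port_mem β (r ρ β) x⟩)⟩,
          Finset.mem_image_of_mem _ (Finset.mem_univ x)⟩
      · intro h
        funext d
        obtain ⟨d, hd⟩ := d
        obtain ⟨x, -, rfl⟩ := Finset.mem_image.1 hd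
        exact congrFun h x
    by_cases h : (D ρ τ).outcome β s = t
    · rw [if_pos h, if_pos (hiff.2 h), mul_comm]
    · rw [if_neg h, if_neg (fun h' => h (hiff.1 h')), mul_zero, mul_zero]
  rw [e]
  refine (convex_convexHull ℝ _).sum_mem (fun i _ => mul_nonneg (hP _) (hQ _)) ?_
    fun i _ => subset_convexHull ℝ _ ⟨_, rfl⟩
  rw [Fintype.sum_prod_type]
  simp only [← Finset.mul_sum]
  exact (Finset.sum_congr rfl fun ρ _ => by rw [hQ1, mul_one]).trans hsum

/-- Mixing with a deterministic behavior is a noncontextual wiring: a shared random bit decides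
whether the given box is used or its outcomes are replaced by `t`. The post-processing box reports
the outcome that is fed into it. -/
theorem NCWConverts.mix_deterministic {Υ : Scenario} (A B : Υ.ND) (t : ∀ x, Υ.O x) (w : ℝ)
    (hw0 : 0 ≤ w) (hw1 : w ≤ 1)
    (h : (B : Υ.Table) = w • (A : Υ.Table) + (1 - w) • Scenario.deterministic t) :
    NCWConverts ⟨Υ, A⟩ ⟨Υ, B⟩ := by
  -- A measurement `⟨x, o⟩` of the post-processing box has the outcome `o` with certainty; its
  -- contexts are the graphs of the joint outcomes.
  let C : Set (Finset (Σ x, Υ.O x)) :=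
    {δ | ∃ β : Υ.contexts, ∃ s : Υ.Outcome β.1,
      δ = Finset.univ.image fun x : {x // x ∈ β.1} => (⟨x.1, s x⟩ : Σ x, Υ.O x)}
  have hC : ∀ γ ∈ C, ∀ γ' ∈ C, γ ⊆ γ' → γ = γ' := by
    rintro _ ⟨β, s, rfl⟩ _ ⟨β', s', rfl⟩ hsub
    have key : ∀ x : {x // x ∈ β.1}, ∃ hx : x.1 ∈ β'.1, s' ⟨x.1, hx⟩ = s x := by
      intro x
      obtain ⟨y, -, hy⟩ := Finset.mem_image.1 (hsub (Finset.mem_image_of_mem _ (Finset.mem_univ x)))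
      obtain ⟨x, hx⟩ := x
      obtain ⟨y, hy'⟩ := y
      obtain ⟨rfl, h2⟩ := Sigma.mk.inj_iff.1 hy
      exact ⟨hy', eq_of_heq h2⟩
    have hβ : β = β' :=
      Subtype.ext (Υ.antichain _ β.2 _ β'.2 fun x hx => (key ⟨x, hx⟩).1)
    subst hβ
    have hs : s = s' := by
      funext x
      exact (key x).2.symm
    rw [hs]
  let one : ∀ _ : Υ.M, Bool := fun _ => true
  let zero : ∀ _ : Υ.M, Bool := fun _ => false
  let pre : (Υ.withOutcomes fun _ => Bool).Table :=
    w • Scenario.deterministic one + (1 - w) • Scenario.deterministic zero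
  have hpre : pre ∈ (Υ.withOutcomes fun _ => Bool).NC :=
    Scenario.convex_NC (Scenario.deterministic_mem_NC _) (Scenario.deterministic_mem_NC _)
      hw0 (by linarith) (by ring)
  let W : Wiring Υ Υ :=
    { R := fun _ => Bool
      pre := pre
      pre_mem := hpre
      f := fun β _ => β
      port := fun x _ => x
      port_mem := fun β _ x => x.2
      N := Υ.O
      postContexts := C
      postAntichain := hC
      post := Scenario.deterministic (Υ := Υ.postScenario Υ.O C hC) fun d => d.2
      post_mem := Scenario.deterministic_mem_NC _
      g := fun x ρ o => if ρ then o else t x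
      g_mem := fun β r s => ⟨β, fun x => if r.1 x then s x else t x.1, rfl⟩ }
  refine ⟨W, ?_⟩
  funext β u
  -- the distribution of the result when the shared random bits are `q`
  let G : (∀ x : {x // x ∈ β.1}, Bool) → ℝ := fun q =>
    ∑ s : Υ.Outcome β.1, (A : Υ.Table) β s *
      if (fun x : {x // x ∈ β.1} => if q x then s x else t x.1) = u then 1 else 0
  have h1 : W.apply (A : Υ.Table) β u = ∑ q, pre β q * G q := by
    have h6 : W.apply (A : Υ.Table) β u =
        ∑ q : {q : (∀ x : {x // x ∈ β.1}, Bool) // 0 < pre β q}, pre β q.1 * G q.1 := by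
      simp only [Wiring.apply, G, Finset.mul_sum, mul_assoc]
      refine Finset.sum_congr rfl fun q _ => Finset.sum_congr rfl fun s _ => ?_
      refine congrArg (fun v => pre β q.1 * ((A : Υ.Table) β s * v)) (if_congr ?_ rfl rfl)
      constructor
      · intro e
        funext x
        exact congrFun e ⟨⟨x.1, if q.1 x then s x else t x.1⟩,
          Finset.mem_image_of_mem (fun x : {x // x ∈ β.1} =>
            (⟨x.1, if q.1 x then s x else t x.1⟩ : Σ x, Υ.O x)) (Finset.mem_univ x)⟩
      · intro e
        funext d
        obtain ⟨d, hd⟩ := d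
        obtain ⟨x, -, rfl⟩ := Finset.mem_image.1 hd
        exact congrFun e x
    rw [h6]
    refine (Finset.sum_subtype (Finset.univ.filter fun q => 0 < pre β q) (by simp)
      fun q => pre β q * G q).symm.trans (Finset.sum_filter_of_ne fun q _ hq => ?_)
    exact ((hpre.1 β).1 q).lt_of_ne fun h0 => hq (by rw [← h0, zero_mul])
  have h2 : ∀ (b : Bool), ∑ q, Scenario.deterministic (Υ := Υ.withOutcomes fun _ => Bool)
      (fun _ => b) β q * G q = G fun _ => b := by
    intro b
    simp [Scenario.deterministic]
  have h3 : ∑ q, pre β q * G q = w * G (fun _ => true) + (1 - w) * G (fun _ => false) := by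
    rw [← h2, ← h2]
    simp only [pre, Pi.add_apply, Pi.smul_apply, smul_eq_mul, add_mul, Finset.sum_add_distrib,
      Finset.mul_sum, mul_assoc, one, zero]
  have h4 : G (fun _ => true) = (A : Υ.Table) β u := by
    simp [G]
  have h5 : G (fun _ => false) = Scenario.deterministic t β u := by
    simp [G, Scenario.deterministic, (A.2.1 β).2]
  rw [h1, h3, h4, h5, h]
  rfl

/-! ### Contexts and correlations of the cycle scenario -/

namespace Cycle

open Scenario

variable {n : ℕ} [NeZero n]

/-- The sign `(-1) ^ b` of an outcome. -/
def sgn (b : Bool) : ℤ := if b then -1 else 1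

theorem sgn_mul_self (b : Bool) : sgn b * sgn b = 1 := by cases b <;> rfl

theorem sgn_not (b : Bool) : sgn (!b) = -sgn b := by cases b <;> rfl

theorem sgn_mul_sgn_eq (b b' : Bool) : sgn b * sgn b' = 1 ∨ sgn b * sgn b' = -1 := by
  cases b <;> cases b' <;> simp [sgn]

theorem sgn_mul_sgn (b b' : Bool) : sgn b * sgn b' = if b = b' then 1 else -1 := by
  cases b <;> cases b' <;> simp [sgn]

omit [NeZero n] in
theorem add_one_ne (hn : 3 ≤ n) (i : ZMod n) : i + 1 ≠ i := by
  have : Fact (1 < n) := ⟨by omega⟩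
  simp

omit [NeZero n] in
theorem add_one_add_one_ne (hn : 3 ≤ n) (i : ZMod n) : i + 1 + 1 ≠ i := by
  intro h
  have h2 : ((2 : ℕ) : ZMod n) = 0 := by
    push_cast
    linear_combination h
  rw [ZMod.natCast_eq_zero_iff] at h2
  exact absurd (Nat.le_of_dvd (by norm_num) h2) (by omega)

theorem mem_edge {i j : ZMod n} : i ∈ (edge j).1 ↔ i = j ∨ i = j + 1 := by
  change i ∈ ({j, j + 1} : Finset (ZMod n)) ↔ _
  simp

theorem left_mem_edge (i : ZMod n) : i ∈ (edge i).1 := mem_edge.2 (Or.inl rfl)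

theorem right_mem_edge (i : ZMod n) : i + 1 ∈ (edge i).1 := mem_edge.2 (Or.inr rfl)

theorem eq_of_mem_edge (hn : 3 ≤ n) {i j : ZMod n} (h : i ∈ (edge j).1) (h' : i + 1 ∈ (edge j).1) :
    i = j := by
  rcases mem_edge.1 h with rfl | rfl
  · rfl
  · rcases mem_edge.1 h' with h' | h'
    · exact absurd h' (add_one_add_one_ne hn j)
    · exact absurd h' (add_one_ne hn (j + 1))

theorem exists_eq_edge (γ : (cycleScenario n).contexts) : ∃ i, γ = edge i := by
  obtain ⟨_, i, rfl⟩ := γ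
  exact ⟨i, rfl⟩

/-- The outcome of `x_i` in the context `{x_i, x_{i+1}}`. -/
def left (i : ZMod n) (s : (cycleScenario n).Outcome (edge i).1) : Bool :=
  s ⟨i, left_mem_edge i⟩

/-- The outcome of `x_{i+1}` in the context `{x_i, x_{i+1}}`. -/
def right (i : ZMod n) (s : (cycleScenario n).Outcome (edge i).1) : Bool :=
  s ⟨i + 1, right_mem_edge i⟩

theorem edge_outcome_ext {i : ZMod n} {s s' : (cycleScenario n).Outcome (edge i).1}
    (hl : left i s = left i s') (hr : right i s = right i s') : s = s' := by
  funext x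
  obtain ⟨x, hx⟩ := x
  rcases mem_edge.1 hx with rfl | rfl
  exacts [hl, hr]

/-- The joint outcome `(b, b')` in the context `{x_i, x_{i+1}}`. -/
def edgeOutcome (i : ZMod n) (b b' : Bool) : (cycleScenario n).Outcome (edge i).1 :=
  fun x => Function.update (fun _ : ZMod n => b') i b x.1

@[simp]
theorem left_edgeOutcome (i : ZMod n) (b b' : Bool) : left i (edgeOutcome i b b') = b :=
  Function.update_self (β := fun _ : ZMod n => Bool) i b fun _ => b'

theorem right_edgeOutcome (hn : 3 ≤ n) (i : ZMod n) (b b' : Bool) :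
    right i (edgeOutcome i b b') = b' :=
  Function.update_of_ne (β := fun _ : ZMod n => Bool) (add_one_ne hn i) b fun _ => b'

theorem sum_edge_outcome (hn : 3 ≤ n) (i : ZMod n)
    (F : (cycleScenario n).Outcome (edge i).1 → ℝ) :
    ∑ s, F s = F (edgeOutcome i true true) + F (edgeOutcome i true false) +
      (F (edgeOutcome i false true) + F (edgeOutcome i false false)) := by
  let e : Bool × Bool ≃ (cycleScenario n).Outcome (edge i).1 :=
    { toFun := fun b => edgeOutcome i b.1 b.2
      invFun := fun s => (left i s, right i s)
      left_inv := fun b => Prod.ext (left_edgeOutcome i b.1 b.2) (right_edgeOutcome hn i b.1 b.2)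
      right_inv := fun s => edge_outcome_ext (left_edgeOutcome i _ _)
        (right_edgeOutcome hn i _ _) }
  rw [← e.sum_comp, Fintype.sum_prod_type]
  simp only [Fintype.sum_bool]
  rfl

theorem corr_eq (B : (cycleScenario n).Table) (i : ZMod n) :
    corr B i = ∑ s, ((sgn (left i s) * sgn (right i s) : ℤ) : ℝ) * B (edge i) s := by
  unfold corr
  refine Finset.sum_congr rfl fun s _ => ?_
  rw [sgn_mul_sgn]
  by_cases h : left i s = right i s
  · have h' : Agree i s := h
    simp [h, h']
  · have h' : ¬ Agree i s := h
    simp [h, h']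

theorem cycleFunctional_combination (a : ZMod n → ℤ) (p q : (cycleScenario n).Table) (b c : ℝ) :
    cycleFunctional a (b • p + c • q) = b * cycleFunctional a p + c * cycleFunctional a q := by
  simp only [cycleFunctional, corr_eq, Pi.add_apply, Pi.smul_apply, smul_eq_mul, Finset.mul_sum,
    ← Finset.sum_add_distrib]
  refine Finset.sum_congr rfl fun i _ => Finset.sum_congr rfl fun s _ => ?_
  ring

theorem sign_mul_corr_le_one {B : (cycleScenario n).Table} (hB : B ∈ (cycleScenario n).behaviors)
    {a : ZMod n → ℤ} (ha : ∀ i, a i = 1 ∨ a i = -1) (i : ZMod n) : (a i : ℝ) * corr B i ≤ 1 := by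
  rw [← (hB (edge i)).2, corr_eq, Finset.mul_sum]
  refine Finset.sum_le_sum fun s _ => ?_
  have h := (hB (edge i)).1 s
  rcases ha i with h1 | h1 <;> rcases sgn_mul_sgn_eq (left i s) (right i s) with h2 | h2 <;>
    rw [h1, h2] <;> push_cast <;> linarith

theorem cycleFunctional_le {B : (cycleScenario n).Table} (hB : B ∈ (cycleScenario n).behaviors)
    {a : ZMod n → ℤ} (ha : ∀ i, a i = 1 ∨ a i = -1) : cycleFunctional a B ≤ n := by
  have h := Finset.sum_le_sum fun (i : ZMod n) (_ : i ∈ Finset.univ) => sign_mul_corr_le_one hB ha i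
  simpa [cycleFunctional, ZMod.card] using h

/-! ### Deterministic points -/

/-- The deterministic behavior of the cycle scenario with the outcomes `σ`. -/
def detBox (σ : ZMod n → Bool) : (cycleScenario n).Table :=
  deterministic (Υ := cycleScenario n) σ

theorem detBox_mem_NC (σ : ZMod n → Bool) : detBox σ ∈ (cycleScenario n).NC :=
  deterministic_mem_NC _

theorem detBox_edge (σ : ZMod n → Bool) (i : ZMod n)
    (s : (cycleScenario n).Outcome (edge i).1) :
    detBox σ (edge i) s = if σ i = left i s ∧ σ (i + 1) = right i s then 1 else 0 := by
  unfold detBox deterministic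
  by_cases h : σ i = left i s ∧ σ (i + 1) = right i s
  · rw [if_pos h]
    exact if_pos (edge_outcome_ext (s := fun x => σ x.1) h.1 h.2)
  · rw [if_neg h]
    refine if_neg fun h' => h ?_
    subst h'
    exact ⟨rfl, rfl⟩

theorem corr_detBox (hn : 3 ≤ n) (σ : ZMod n → Bool) (i : ZMod n) :
    corr (detBox σ) i = ((sgn (σ i) * sgn (σ (i + 1)) : ℤ) : ℝ) := by
  rw [corr_eq, sum_edge_outcome hn]
  simp only [detBox_edge, left_edgeOutcome, right_edgeOutcome hn]
  generalize σ i = z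
  generalize σ (i + 1) = w
  cases z <;> cases w <;> simp [sgn]

theorem OddSigns.prod_eq {a : ZMod n → ℤ} (ha : OddSigns a) : ∏ i, a i = -1 := by
  have h : ∀ i, a i = if a i = -1 then -1 else 1 := by
    intro i
    rcases ha.1 i with h | h <;> rw [h] <;> norm_num
  rw [Finset.prod_congr rfl fun i _ => h i, Finset.prod_ite]
  simp [ha.2.neg_one_pow]

theorem prod_add_one {R : Type*} [CommMonoid R] (f : ZMod n → R) : ∏ i, f (i + 1) = ∏ i, f i :=
  Fintype.prod_equiv (Equiv.addRight (1 : ZMod n)) _ _ fun _ => rfl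

theorem prod_sgn_mul_sgn (σ : ZMod n → Bool) : ∏ i, sgn (σ i) * sgn (σ (i + 1)) = 1 := by
  rw [Finset.prod_mul_distrib, prod_add_one fun i => sgn (σ i), ← Finset.prod_mul_distrib]
  simp [sgn_mul_self]

/-- The product of all terms `a_i σ_i σ_{i+1}` is `-1`, so one of them is `-1`. -/
theorem OddSigns.exists_ne {a : ZMod n → ℤ} (ha : OddSigns a) (σ : ZMod n → Bool) :
    ∃ i, a i = -(sgn (σ i) * sgn (σ (i + 1))) := by
  by_contra! h
  have h1 : ∀ i, a i = sgn (σ i) * sgn (σ (i + 1)) := by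
    intro i
    have := h i
    rcases ha.1 i with h1 | h1 <;> rcases sgn_mul_sgn_eq (σ i) (σ (i + 1)) with h2 | h2 <;>
      simp_all
  have h2 := OddSigns.prod_eq ha
  rw [Finset.prod_congr rfl fun i _ => h1 i, prod_sgn_mul_sgn] at h2
  norm_num at h2

theorem cycleFunctional_detBox_le (hn : 3 ≤ n) {a : ZMod n → ℤ} (ha : OddSigns a)
    (σ : ZMod n → Bool) :
    cycleFunctional a (detBox σ) ≤ n - 2 := by
  obtain ⟨k, hk⟩ := OddSigns.exists_ne ha σ
  have hB := (detBox_mem_NC σ).1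
  have h1 : ∀ i ∈ Finset.univ.erase k,
      (a i : ℝ) * corr (detBox σ) i ≤ 1 :=
    fun i _ => sign_mul_corr_le_one hB ha.1 i
  have h2 := Finset.sum_le_sum h1
  have h3 : (a k : ℝ) * corr (detBox σ) k = -1 := by
    rw [corr_detBox hn, hk, ← Int.cast_mul]
    rcases sgn_mul_sgn_eq (σ k) (σ (k + 1)) with h | h <;> rw [h] <;> norm_num
  have hpos : 1 ≤ n := NeZero.one_le
  rw [Finset.sum_const, Finset.card_erase_of_mem (Finset.mem_univ _), Finset.card_univ, ZMod.card,
    nsmul_eq_mul, mul_one, Nat.cast_sub hpos] at h2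
  unfold cycleFunctional
  rw [← Finset.add_sum_erase _ _ (Finset.mem_univ k), h3]
  push_cast at h2
  linarith

theorem cycleFunctional_le_of_mem_NC (hn : 3 ≤ n) {a : ZMod n → ℤ} (ha : OddSigns a)
    {B : (cycleScenario n).Table} (hB : B ∈ (cycleScenario n).NC) :
    cycleFunctional a B ≤ n - 2 := by
  rw [NC_eq_convexHull] at hB
  refine convexHull_min (t := {B | cycleFunctional a B ≤ n - 2}) ?_ ?_ hB
  · rintro _ ⟨σ, rfl⟩
    exact cycleFunctional_detBox_le hn ha σ
  · intro p hp q hq b c hb hc hbc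
    simp only [Set.mem_ofPred_eq] at *
    rw [cycleFunctional_combination, ← one_mul ((n : ℝ) - 2), ← hbc, add_mul]
    gcongr

/-- Signs on the edges of a cycle become coboundaries of signs on the vertices once the cycle is
cut open at an edge. -/
theorem exists_potential {c : ZMod n → ℤ} (hc : ∀ i, c i = 1 ∨ c i = -1) (k : ZMod n) :
    ∃ σ : ZMod n → Bool, ∀ i, i ≠ k → c i = sgn (σ i) * sgn (σ (i + 1)) := by
  -- the outcomes along the path that starts at `k + 1`, just behind the cut
  let f : ℕ → Bool := fun m => Nat.rec false (fun m b => if c (k + 1 + m) = 1 then b else !b) m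
  have hf : ∀ m, sgn (f m) * sgn (f (m + 1)) = c (k + 1 + m) := by
    intro m
    have h : f (m + 1) = if c (k + 1 + m) = 1 then f m else !f m := rfl
    rw [h]
    rcases hc (k + 1 + m) with h1 | h1 <;> rw [h1]
    · simp [sgn_mul_self]
    · simp [sgn_not, sgn_mul_self]
  refine ⟨fun i => f (i - (k + 1)).val, fun i hi => ?_⟩
  have h1 : i + 1 - (k + 1) = (i - (k + 1)) + 1 := by ring
  have h2 : (i + 1 - (k + 1)).val = (i - (k + 1)).val + 1 := by
    rw [h1]
    have h3 : (((i - (k + 1)).val + 1 : ℕ) : ZMod n) = i - (k + 1) + 1 := by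
      push_cast
      rw [ZMod.natCast_zmod_val]
    rcases (Nat.succ_le_of_lt (ZMod.val_lt (i - (k + 1)))).lt_or_eq with h4 | h4
    · rw [← h3, ZMod.val_natCast_of_lt h4]
    · rw [Nat.succ_eq_add_one] at h4
      rw [h4, ZMod.natCast_self] at h3
      exact absurd (by linear_combination -h3) hi
  dsimp only
  rw [h2, hf, ZMod.natCast_zmod_val]
  congr 1
  ring

/-! ### Behaviors with perfect correlations -/

open Classical in
/-- The behavior with unbiased outcomes in which the product of the signs of the outcomes of `x_i`
and `x_{i+1}` is always `c i`. -/
def signBox (c : ZMod n → ℤ) : (cycleScenario n).Table := fun γ s =>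
  if ∀ (i : ZMod n) (h : i ∈ γ.1) (h' : i + 1 ∈ γ.1), sgn (s ⟨i, h⟩) * sgn (s ⟨i + 1, h'⟩) = c i
  then 1 / 2 else 0

theorem signBox_edge (hn : 3 ≤ n) (c : ZMod n → ℤ) (i : ZMod n)
    (s : (cycleScenario n).Outcome (edge i).1) :
    signBox c (edge i) s = if sgn (left i s) * sgn (right i s) = c i then 1 / 2 else 0 := by
  unfold signBox
  by_cases h : sgn (left i s) * sgn (right i s) = c i
  · rw [if_pos h, if_pos]
    intro j hj hj'
    obtain rfl := eq_of_mem_edge hn hj hj'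
    exact h
  · rw [if_neg h, if_neg]
    exact fun h' => h (h' i (left_mem_edge i) (right_mem_edge i))

theorem signBox_edge_congr (hn : 3 ≤ n) {c c' : ZMod n → ℤ} {i : ZMod n} (h : c i = c' i) :
    signBox c (edge i) = signBox c' (edge i) := by
  funext s
  rw [signBox_edge hn, signBox_edge hn, h]

theorem signBox_potential (hn : 3 ≤ n) (σ : ZMod n → Bool) :
    signBox (fun i => sgn (σ i) * sgn (σ (i + 1))) =
      (1 / 2 : ℝ) • detBox σ + (1 / 2 : ℝ) • detBox fun i => !σ i := by
  funext γ s
  obtain ⟨i, rfl⟩ := exists_eq_edge γ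
  simp only [Pi.add_apply, Pi.smul_apply, smul_eq_mul]
  rw [signBox_edge hn, detBox_edge, detBox_edge]
  generalize left i s = x
  generalize right i s = y
  generalize σ i = z
  generalize σ (i + 1) = w
  cases x <;> cases y <;> cases z <;> cases w <;> simp [sgn]

theorem signBox_potential_mem_NC (hn : 3 ≤ n) (σ : ZMod n → Bool) :
    signBox (fun i => sgn (σ i) * sgn (σ (i + 1))) ∈ (cycleScenario n).NC := by
  rw [signBox_potential hn]
  exact convex_NC (deterministic_mem_NC _) (deterministic_mem_NC _) (by norm_num) (by norm_num)
    (by norm_num)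

theorem exists_third (hn : 3 ≤ n) (i j : ZMod n) : ∃ k, i ≠ k ∧ j ≠ k := by
  have h : ({i, j} : Finset (ZMod n)).card < (Finset.univ : Finset (ZMod n)).card := by
    rw [Finset.card_univ, ZMod.card]
    exact Finset.card_le_two.trans_lt (by omega)
  obtain ⟨k, -, hk⟩ := Finset.exists_mem_notMem_of_card_lt_card h
  simp only [Finset.mem_insert, Finset.mem_singleton, not_or] at hk
  exact ⟨k, fun h => hk.1 h.symm, fun h => hk.2 h.symm⟩

/-- Two contexts cannot see the sign at a third edge, so on any two contexts the behavior coincides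
with a noncontextual one. -/
theorem signBox_mem_ND (hn : 3 ≤ n) {c : ZMod n → ℤ} (hc : ∀ i, c i = 1 ∨ c i = -1) :
    signBox c ∈ (cycleScenario n).ND := by
  have key : ∀ γ γ' : (cycleScenario n).contexts, ∃ p ∈ (cycleScenario n).ND,
      signBox c γ = p γ ∧ signBox c γ' = p γ' := by
    intro γ γ'
    obtain ⟨i, rfl⟩ := exists_eq_edge γ
    obtain ⟨j, rfl⟩ := exists_eq_edge γ'
    obtain ⟨k, hi, hj⟩ := exists_third hn i j
    obtain ⟨σ, hσ⟩ := exists_potential hc k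
    exact ⟨_, NC_subset_ND (signBox_potential_mem_NC hn σ), signBox_edge_congr hn (hσ i hi),
      signBox_edge_congr hn (hσ j hj)⟩
  constructor
  · intro γ
    obtain ⟨p, hp, h, -⟩ := key γ γ
    rw [h]
    exact hp.1 γ
  · intro γ γ' u
    obtain ⟨p, hp, h, h'⟩ := key γ γ'
    rw [h, h']
    exact hp.2 γ γ' u

theorem corr_signBox (hn : 3 ≤ n) {c : ZMod n → ℤ} (hc : ∀ i, c i = 1 ∨ c i = -1) (i : ZMod n) :
    corr (signBox c) i = c i := by
  rw [corr_eq, sum_edge_outcome hn]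
  simp only [signBox_edge hn, left_edgeOutcome, right_edgeOutcome hn]
  rcases hc i with h | h <;> rw [h] <;> norm_num [sgn]

theorem cycleFunctional_signBox_self (hn : 3 ≤ n) {a : ZMod n → ℤ} (ha : ∀ i, a i = 1 ∨ a i = -1) :
    cycleFunctional a (signBox a) = n := by
  have h : ∀ i, (a i : ℝ) * corr (signBox a) i = 1 := by
    intro i
    rw [corr_signBox hn ha]
    rcases ha i with h | h <;> rw [h] <;> norm_num
  simp [cycleFunctional, h, ZMod.card]

theorem uniform_edge (hn : 3 ≤ n) (i : ZMod n) (s : (cycleScenario n).Outcome (edge i).1) :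
    uniformBehavior n (edge i) s = 1 / 4 := by
  have h := sum_edge_outcome hn i fun _ => 1
  simp only [Finset.sum_const, Finset.card_univ, nsmul_eq_mul, mul_one] at h
  unfold uniformBehavior
  rw [h]
  norm_num

/-- The uniform behavior as a mixture of two perfectly correlated ones, which carries statements
about `signBox` over to it. -/
theorem uniform_eq (hn : 3 ≤ n) {c : ZMod n → ℤ} (hc : ∀ i, c i = 1 ∨ c i = -1) :
    uniformBehavior n = (1 / 2 : ℝ) • signBox c + (1 / 2 : ℝ) • signBox fun i => -c i := by
  funext γ s
  obtain ⟨i, rfl⟩ := exists_eq_edge γ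
  simp only [Pi.add_apply, Pi.smul_apply, smul_eq_mul]
  rw [uniform_edge hn, signBox_edge hn, signBox_edge hn]
  rcases hc i with h | h <;> rcases sgn_mul_sgn_eq (left i s) (right i s) with h' | h' <;>
    rw [h, h'] <;> norm_num

omit [NeZero n] in
theorem neg_signs {c : ZMod n → ℤ} (hc : ∀ i, c i = 1 ∨ c i = -1) (i : ZMod n) :
    -c i = 1 ∨ -c i = -1 := by
  rcases hc i with h | h <;> simp [h]

theorem uniform_mem_ND (hn : 3 ≤ n) : uniformBehavior n ∈ (cycleScenario n).ND := by
  have hc : ∀ _ : ZMod n, (1 : ℤ) = 1 ∨ (1 : ℤ) = -1 := fun _ => Or.inl rfl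
  rw [uniform_eq hn hc]
  exact convex_ND (signBox_mem_ND hn hc) (signBox_mem_ND hn (neg_signs hc)) (by norm_num)
    (by norm_num) (by norm_num)

theorem cycleFunctional_uniform (hn : 3 ≤ n) (a : ZMod n → ℤ) :
    cycleFunctional a (uniformBehavior n) = 0 := by
  refine Finset.sum_eq_zero fun i _ => ?_
  rw [corr_eq, sum_edge_outcome hn]
  simp only [uniform_edge hn, left_edgeOutcome, right_edgeOutcome hn]
  norm_num [sgn]

/-! ### The contextual vertex -/

/-- If `I_a(B) = n`, all correlations are perfect, so the mean value of `x_{i+1}` is `a_i` times the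
mean value of `x_i`. Around the cycle this multiplies the mean value by `∏ a_i = -1`. Hence
all mean values vanish. -/
theorem eq_signBox (hn : 3 ≤ n) {a : ZMod n → ℤ} (ha : OddSigns a) {B : (cycleScenario n).Table}
    (hB : B ∈ (cycleScenario n).ND) (hI : cycleFunctional a B = n) : B = signBox a := by
  have hcorr : ∀ i, (a i : ℝ) * corr B i = 1 := by
    have h : ∑ i, (a i : ℝ) * corr B i = ∑ _i : ZMod n, (1 : ℝ) := by
      simpa [cycleFunctional, ZMod.card] using hI
    intro i
    exact (Finset.sum_eq_sum_iff_of_le fun i _ => sign_mul_corr_le_one hB.1 ha.1 i).1 h i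
      (Finset.mem_univ i)
  have hsupp : ∀ i s, sgn (left i s) * sgn (right i s) ≠ a i → B (edge i) s = 0 := by
    intro i
    have h1 := hcorr i
    rw [← (hB.1 (edge i)).2, corr_eq, Finset.mul_sum, Finset.sum_eq_sum_iff_of_le] at h1
    · intro s hs
      have h2 := h1 s (Finset.mem_univ s)
      rcases ha.1 i with h3 | h3 <;> rcases sgn_mul_sgn_eq (left i s) (right i s) with h4 | h4 <;>
        rw [h3, h4] at h2 hs <;> first | exact absurd rfl hs | (push_cast at h2; linarith)
    · intro s _
      have h := (hB.1 (edge i)).1 s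
      rcases ha.1 i with h1 | h1 <;> rcases sgn_mul_sgn_eq (left i s) (right i s) with h2 | h2 <;>
        rw [h1, h2] <;> push_cast <;> linarith
  -- `m i` is the mean value of `x_i`
  let m : ZMod n → ℝ := fun i => ∑ s, (sgn (left i s) : ℝ) * B (edge i) s
  have hm : ∀ i, m (i + 1) = a i * m i := by
    intro i
    have h1 : m (i + 1) = ∑ s, (sgn (right i s) : ℝ) * B (edge i) s :=
      ND.expectation_eq hB (edge (i + 1)) (edge i) (i + 1) (left_mem_edge _) (right_mem_edge _)
        fun b => ((sgn b : ℤ) : ℝ)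
    rw [h1]
    simp only [m, Finset.mul_sum]
    refine Finset.sum_congr rfl fun s _ => ?_
    by_cases h : sgn (left i s) * sgn (right i s) = a i
    · rw [← h]
      have h2 := sgn_mul_self (left i s)
      have h3 : ((sgn (left i s) : ℤ) : ℝ) * (sgn (left i s) : ℤ) = 1 := by exact_mod_cast h2
      push_cast
      linear_combination (-(sgn (right i s) : ℝ) * B (edge i) s) * h3
    · rw [hsupp i s h]
      ring
  have hprod : ∏ i, m i = 0 := by
    have h1 : ∏ i, m (i + 1) = ∏ i, m i := prod_add_one m
    have h2 : (∏ i, (a i : ℝ)) = -1 := by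
      have := OddSigns.prod_eq ha
      exact_mod_cast this
    simp only [hm, Finset.prod_mul_distrib, h2] at h1
    linarith
  obtain ⟨k, -, hk⟩ := Finset.prod_eq_zero_iff.1 hprod
  have hm0 : ∀ i, m i = 0 := by
    have h1 : ∀ j : ℕ, m (k + j) = 0 := by
      intro j
      induction j with
      | zero => simpa using hk
      | succ j ih =>
        have h : k + ((j + 1 : ℕ) : ZMod n) = k + j + 1 := by push_cast; ring
        rw [h, hm, ih, mul_zero]
    intro i
    have h2 := h1 (i - k).val
    rwa [ZMod.natCast_zmod_val, add_sub_cancel] at h2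
  funext γ s
  obtain ⟨i, rfl⟩ := exists_eq_edge γ
  have h1 := hm0 i
  have h2 := (hB.1 (edge i)).2
  have h3 := fun b b' => hsupp i (edgeOutcome i b b')
  simp only [m, sum_edge_outcome hn, left_edgeOutcome] at h1 h2
  simp only [left_edgeOutcome, right_edgeOutcome hn] at h3
  have h4 : s = edgeOutcome i (left i s) (right i s) :=
    edge_outcome_ext (left_edgeOutcome i _ _).symm (right_edgeOutcome hn i _ _).symm
  rw [h4, signBox_edge hn, left_edgeOutcome, right_edgeOutcome hn]
  generalize left i s = x
  generalize right i s = y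
  have h5 := h3 true true
  have h6 := h3 true false
  have h7 := h3 false true
  have h8 := h3 false false
  rcases ha.1 i with h | h <;> rw [h] at h5 h6 h7 h8 ⊢ <;> norm_num [sgn] at h1 h5 h6 h7 h8 <;>
    cases x <;> cases y <;> norm_num [sgn] <;> linarith

/-- `signBox a` is the only nondisturbing behavior on which `I_a` attains its maximum `n`, so it is
a vertex; it is contextual because `n > n - 2`. -/
theorem signBox_mem_NDC (hn : 3 ≤ n) {a : ZMod n → ℤ} (ha : OddSigns a) : signBox a ∈ NDC n := by
  refine ⟨mem_extremePoints_iff_left.2 ⟨signBox_mem_ND hn ha.1, ?_⟩, fun h => ?_⟩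
  · rintro p hp q hq ⟨b, c, hb, hc, hbc, h⟩
    refine eq_signBox hn ha hp ?_
    have h1 := cycleFunctional_signBox_self hn ha.1
    rw [← h, cycleFunctional_combination] at h1
    have h2 := cycleFunctional_le hp.1 ha.1
    have h3 := cycleFunctional_le hq.1 ha.1
    refine le_antisymm h2 ?_
    have h4 : c = 1 - b := by linarith
    subst h4
    nlinarith [mul_le_mul_of_nonneg_left h3 hc.le]
  · have h1 := cycleFunctional_le_of_mem_NC hn ha h.1
    rw [cycleFunctional_signBox_self hn ha.1] at h1
    linarith

/-- Cut the cycle at the edge `0`: a potential for `a` satisfies all terms of `I_a` except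
this one. -/
theorem saturatingVertices_nonempty (hn : 3 ≤ n) {a : ZMod n → ℤ} (ha : OddSigns a) :
    (saturatingVertices a).Nonempty := by
  obtain ⟨σ, hσ⟩ := exists_potential ha.1 0
  refine ⟨detBox σ, deterministic_mem_extremePoints_NC (Υ := cycleScenario n) σ, ?_⟩
  obtain ⟨k, hk⟩ := OddSigns.exists_ne ha σ
  have hk0 : k = 0 := by
    by_contra h
    have h1 := hσ k h
    rcases sgn_mul_sgn_eq (σ k) (σ (k + 1)) with h2 | h2 <;> omega
  subst hk0
  have h1 : ∀ i, (a i : ℝ) * corr (detBox σ) i =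
      if i = 0 then 1 - 2 else 1 := by
    intro i
    rw [corr_detBox hn, ← Int.cast_mul]
    split_ifs with h
    · subst h
      rw [hk]
      rcases sgn_mul_sgn_eq (σ 0) (σ (0 + 1)) with h2 | h2 <;> rw [h2] <;> norm_num
    · rw [hσ i h]
      rcases sgn_mul_sgn_eq (σ i) (σ (i + 1)) with h2 | h2 <;> rw [h2] <;> norm_num
  have h2 : ∀ i : ZMod n, (if i = 0 then (1 - 2 : ℝ) else 1) = 1 - if i = 0 then 2 else 0 := by
    intro i
    split_ifs <;> norm_num
  simp [cycleFunctional, h1, h2, Finset.sum_sub_distrib, ZMod.card]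

/-! ### Deterministic wirings of the cycle scenario -/

/-- The wiring makes no use of the outcome of the measurement `k`. -/
def Ignores (D : DetWiring (cycleScenario n) (cycleScenario n)) (k : ZMod n) : Prop :=
  ∀ x, D.port x = k → ∀ o o', D.out x o = D.out x o'

theorem Ignores.outcome_eq {D : DetWiring (cycleScenario n) (cycleScenario n)} {k : ZMod n}
    (h : Ignores D k) (β : (cycleScenario n).contexts)
    {s s' : (cycleScenario n).Outcome (D.ctx β).1} (hs : ∀ y, y.1 ≠ k → s y = s' y) :
    D.outcome β s = D.outcome β s' := by
  funext x
  by_cases hx : D.port x.1 = k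
  · exact h _ hx _ _
  · exact congrArg (D.out x.1) (hs ⟨_, _⟩ hx)

/-- If the outcome of `x_{k+1}` is not used, the sign of the correlation of `x_k` and `x_{k+1}` has
no influence on the sums over joint outcomes. -/
theorem sum_mul_signBox_congr (hn : 3 ≤ n) {c c' : ZMod n → ℤ} (hc : ∀ i, c i = 1 ∨ c i = -1)
    (hc' : ∀ i, c' i = 1 ∨ c' i = -1) {k : ZMod n} (h : ∀ i, i ≠ k → c i = c' i)
    (γ : (cycleScenario n).contexts) (w : (cycleScenario n).Outcome γ.1 → ℝ)
    (hw : ∀ s s', (∀ y, y.1 ≠ k + 1 → s y = s' y) → w s = w s') :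
    ∑ s, w s * signBox c γ s = ∑ s, w s * signBox c' γ s := by
  obtain ⟨i, rfl⟩ := exists_eq_edge γ
  by_cases hi : i = k
  · subst hi
    have h1 : ∀ b, w (edgeOutcome i b true) = w (edgeOutcome i b false) := by
      intro b
      refine hw _ _ fun y hy => ?_
      obtain ⟨y, hy'⟩ := y
      rcases mem_edge.1 hy' with rfl | rfl
      · exact (left_edgeOutcome y b true).trans (left_edgeOutcome y b false).symm
      · exact absurd rfl hy
    rw [sum_edge_outcome hn, sum_edge_outcome hn, h1, h1]
    simp only [signBox_edge hn, left_edgeOutcome, right_edgeOutcome hn]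
    rcases hc i with h2 | h2 <;> rcases hc' i with h3 | h3 <;> rw [h2, h3] <;> simp [sgn]
  · rw [signBox_edge_congr hn (h i hi)]

theorem Ignores.cycleFunctional_apply_signBox_le (hn : 3 ≤ n)
    {D : DetWiring (cycleScenario n) (cycleScenario n)} {k : ZMod n} (h : Ignores D k)
    {a c : ZMod n → ℤ} (ha : OddSigns a) (hc : ∀ i, c i = 1 ∨ c i = -1) :
    cycleFunctional a (D.apply (signBox c)) ≤ n - 2 := by
  -- only the sign on the edge `{x_{k-1}, x_k}` may have to be changed
  obtain ⟨σ, hσ⟩ := exists_potential hc (k - 1)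
  have h1 : D.apply (signBox c) = D.apply (signBox fun i => sgn (σ i) * sgn (σ (i + 1))) := by
    funext β t
    have h2 := sum_mul_signBox_congr hn hc (fun i => sgn_mul_sgn_eq (σ i) (σ (i + 1))) hσ
      (D.ctx β) (fun s => if D.outcome β s = t then 1 else 0) fun s s' hs => by
        rw [sub_add_cancel] at hs
        rw [h.outcome_eq β hs]
    simp only [ite_mul, one_mul, zero_mul] at h2
    exact h2
  rw [h1]
  exact cycleFunctional_le_of_mem_NC hn ha (D.apply_mem_NC (signBox_potential_mem_NC hn σ))

theorem Ignores.cycleFunctional_apply_uniform_le (hn : 3 ≤ n)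
    {D : DetWiring (cycleScenario n) (cycleScenario n)} {k : ZMod n} (h : Ignores D k)
    {a : ZMod n → ℤ} (ha : OddSigns a) :
    cycleFunctional a (D.apply (uniformBehavior n)) ≤ n - 2 := by
  rw [uniform_eq hn ha.1, map_add, map_smul, map_smul, cycleFunctional_combination]
  have h1 := h.cycleFunctional_apply_signBox_le hn ha ha.1
  have h2 := h.cycleFunctional_apply_signBox_le hn ha (neg_signs ha.1)
  linarith

/-- A wiring that uses all measurements permutes them and their outcomes, so any joint outcome can
be obtained. -/
theorem exists_preimage_of_not_ignores {D : DetWiring (cycleScenario n) (cycleScenario n)}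
    (h : ∀ k, ¬ Ignores D k) (t : ZMod n → Bool) :
    ∃ s : ZMod n → Bool, ∀ x : ZMod n, D.out x (s (D.port x)) = t x := by
  have h1 : ∀ k : ZMod n, ∃ x : ZMod n, D.port x = k ∧ ∃ o o', D.out x o ≠ D.out x o' := by
    intro k
    have := h k
    unfold Ignores at this
    push Not at this
    exact this
  have hsurj : Function.Surjective (D.port : ZMod n → ZMod n) := fun k =>
    (h1 k).imp fun x hx => hx.1
  have hinj : Function.Injective (D.port : ZMod n → ZMod n) :=
    Finite.injective_iff_surjective.2 hsurj
  have h2 : ∀ x : ZMod n, ∃ o : Bool, D.out x o = t x := by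
    intro x
    obtain ⟨y, hy, o, o', hne⟩ := h1 (D.port x)
    obtain rfl := hinj hy
    have key : ∀ p q r : Bool, p ≠ q → p = r ∨ q = r := by decide
    rcases key _ _ (t y) hne with h | h
    exacts [⟨o, h⟩, ⟨o', h⟩]
  choose o ho using h2
  obtain ⟨e, he⟩ := hsurj.hasRightInverse
  refine ⟨fun k => o (e k), fun x => ?_⟩
  have h3 : e (D.port x) = x := hinj (he _)
  change D.out x (o (e (D.port x))) = t x
  rw [h3]
  exact ho x

/-- Every joint outcome has at least one preimage, so its probability is at least `1/4`; by
normalization it is exactly `1/4`. -/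
theorem apply_uniform_of_not_ignores (hn : 3 ≤ n)
    {D : DetWiring (cycleScenario n) (cycleScenario n)} (h : ∀ k, ¬ Ignores D k) :
    D.apply (uniformBehavior n) = uniformBehavior n := by
  have hu : ∀ γ s, uniformBehavior n γ s = 1 / 4 := by
    intro γ s
    obtain ⟨i, rfl⟩ := exists_eq_edge γ
    exact uniform_edge hn i s
  have hge : ∀ β t, uniformBehavior n β t ≤ D.apply (uniformBehavior n) β t := by
    intro β t
    obtain ⟨u, hut⟩ : ∃ u, D.outcome β u = t := by
      obtain ⟨s, hs⟩ := exists_preimage_of_not_ignores h fun x =>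
        open Classical in if hx : x ∈ β.1 then t ⟨x, hx⟩ else false
      refine ⟨fun y => s y.1, ?_⟩
      funext x
      exact (hs x.1).trans (dif_pos x.2)
    have h1 := Finset.single_le_sum
      (f := fun s => if D.outcome β s = t then uniformBehavior n (D.ctx β) s else 0)
      (fun s _ => by split_ifs; exacts [by rw [hu]; norm_num, le_rfl])
      (Finset.mem_univ u)
    rw [if_pos hut, hu] at h1
    rw [hu]
    exact h1
  funext β t
  have h1 := ((uniform_mem_ND hn).1 β).2
  rw [← (D.apply_mem_behaviors (uniform_mem_ND hn).1 β).2,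
    Finset.sum_eq_sum_iff_of_le fun t _ => hge β t] at h1
  exact (h1 t (Finset.mem_univ t)).symm

/-! ### The two-parameter family -/

/-- `B_ε` is the contextual vertex with white noise of weight `(1 - ε) (2 / n)`. -/
theorem segmentBehavior_eq (B : (cycleScenario n).Table) (ε : ℝ) :
    segmentBehavior B ε =
      (1 - (1 - ε) * (2 / n)) • B + ((1 - ε) * (2 / n)) • uniformBehavior n := by
  have h : (n : ℝ) ≠ 0 := Nat.cast_ne_zero.2 (NeZero.ne n)
  have h1 : ((n : ℝ) - 2) / n = 1 - 2 / n := by field_simp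
  unfold segmentBehavior
  rw [h1]
  module

omit [NeZero n] in
theorem weight_mem (hn : 3 ≤ n) {ε : ℝ} (h0 : 0 ≤ ε) (h1 : ε ≤ 1) :
    0 ≤ (1 - ε) * (2 / n) ∧ (1 - ε) * (2 / n) ≤ 1 := by
  have hn' : (3 : ℝ) ≤ n := by exact_mod_cast hn
  have h2 : (2 : ℝ) / n ≤ 1 := (div_le_one (by linarith)).2 (by linarith)
  have h3 : (0 : ℝ) ≤ 2 / n := by positivity
  constructor <;> nlinarith

theorem familyBehavior_mem_ND (hn : 3 ≤ n) {a : ZMod n → ℤ} (ha : OddSigns a)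
    {Bt : (cycleScenario n).Table} (hBt : Bt ∈ (cycleScenario n).NC) {α ε : ℝ} (hα0 : 0 ≤ α)
    (hα1 : α ≤ 1) (hε0 : 0 ≤ ε) (hε1 : ε ≤ 1) :
    familyBehavior (signBox a) Bt α ε ∈ (cycleScenario n).ND := by
  obtain ⟨h1, h2⟩ := weight_mem hn hε0 hε1
  unfold familyBehavior
  rw [segmentBehavior_eq]
  exact convex_ND (NC_subset_ND hBt) (convex_ND (signBox_mem_ND hn ha.1) (uniform_mem_ND hn)
    (by linarith) h1 (by ring)) hα0 (by linarith) (by ring)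

theorem cycleFunctional_familyBehavior (hn : 3 ≤ n) {a : ZMod n → ℤ} (ha : OddSigns a)
    {Bt : (cycleScenario n).Table} (hBt : cycleFunctional a Bt = n - 2) (α ε : ℝ) :
    cycleFunctional a (familyBehavior (signBox a) Bt α ε) = n - 2 + 2 * (1 - α) * ε := by
  have h : (n : ℝ) ≠ 0 := Nat.cast_ne_zero.2 (NeZero.ne n)
  unfold familyBehavior
  rw [segmentBehavior_eq, cycleFunctional_combination, cycleFunctional_combination, hBt,
    cycleFunctional_signBox_self hn ha.1, cycleFunctional_uniform hn]
  field_simp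
  ring

/-- A deterministic wiring either destroys the violation of the inequality labelled by `a`, or it is
a relabelling, which preserves the white noise in the behavior. -/
theorem detWiring_apply_familyBehavior (hn : 3 ≤ n)
    (D : DetWiring (cycleScenario n) (cycleScenario n)) {a : ZMod n → ℤ} (ha : OddSigns a)
    {Bt : (cycleScenario n).Table} (hBt : Bt ∈ (cycleScenario n).NC) {α ε : ℝ} (hα0 : 0 ≤ α)
    (hα1 : α ≤ 1) (hε0 : 0 ≤ ε) (hε1 : ε ≤ 1) :
    cycleFunctional a (D.apply (familyBehavior (signBox a) Bt α ε)) ≤ n - 2 ∨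
      cycleFunctional a (D.apply (familyBehavior (signBox a) Bt α ε)) ≤ n - 2 + 2 * (1 - α) * ε ∧
      ∀ i s, (1 - α) * (1 - ε) / (2 * n) ≤
        D.apply (familyBehavior (signBox a) Bt α ε) (edge i) s := by
  obtain ⟨hw0, hw1⟩ := weight_mem hn hε0 hε1
  have hn0 : (n : ℝ) ≠ 0 := Nat.cast_ne_zero.2 (NeZero.ne n)
  have hwn : (1 - ε) * (2 / n) * n = 2 * (1 - ε) := by field_simp
  have hw : (1 - α) * (1 - ε) / (2 * n) = (1 - α) * ((1 - ε) * (2 / n) * (1 / 4)) := by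
    field_simp
    norm_num
  have hα : 0 ≤ 1 - α := by linarith
  unfold familyBehavior
  rw [segmentBehavior_eq]
  simp only [map_add, map_smul]
  rw [hw, cycleFunctional_combination, cycleFunctional_combination]
  have h1 := cycleFunctional_le_of_mem_NC hn ha (D.apply_mem_NC hBt)
  generalize (1 - ε) * (2 / (n : ℝ)) = w at *
  have hw' : 0 ≤ 1 - w := by linarith
  by_cases h : ∃ k, Ignores D k
  · left
    obtain ⟨k, hk⟩ := h
    have h2 := hk.cycleFunctional_apply_signBox_le hn ha ha.1
    have h3 := hk.cycleFunctional_apply_uniform_le hn ha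
    have h4 := add_le_add (mul_le_mul_of_nonneg_left h2 hw') (mul_le_mul_of_nonneg_left h3 hw0)
    have h5 := add_le_add (mul_le_mul_of_nonneg_left h1 hα0) (mul_le_mul_of_nonneg_left h4 hα)
    linarith
  · right
    push Not at h
    rw [apply_uniform_of_not_ignores hn h, cycleFunctional_uniform hn]
    have hS := D.apply_mem_behaviors (signBox_mem_ND hn ha.1).1
    constructor
    · have h2 := cycleFunctional_le hS ha.1
      have h4 := mul_le_mul_of_nonneg_left h2 hw'
      have h5 : (1 - w) * cycleFunctional a (D.apply (signBox a)) + w * 0 ≤ n - 2 * (1 - ε) := by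
        linarith
      have h6 := add_le_add (mul_le_mul_of_nonneg_left h1 hα0) (mul_le_mul_of_nonneg_left h5 hα)
      linarith
    · intro i s
      have h2 := mul_nonneg hw' ((hS (edge i)).1 s)
      have h3 := mul_nonneg hα0 ((D.apply_mem_behaviors hBt.1 (edge i)).1 s)
      have h4 := mul_nonneg hα h2
      simp only [Pi.add_apply, Pi.smul_apply, smul_eq_mul, uniform_edge hn]
      linarith

/-- Wirings do not increase the violation. -/
theorem cycleFunctional_wiring_le (hn : 3 ≤ n) (W : Wiring (cycleScenario n) (cycleScenario n))
    {a : ZMod n → ℤ} (ha : OddSigns a) {Bt : (cycleScenario n).Table}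
    (hBt : Bt ∈ (cycleScenario n).NC) {α ε : ℝ} (hα0 : 0 ≤ α) (hα1 : α ≤ 1) (hε0 : 0 ≤ ε)
    (hε1 : ε ≤ 1) :
    cycleFunctional a (W.apply (familyBehavior (signBox a) Bt α ε)) ≤ n - 2 + 2 * (1 - α) * ε := by
  refine convexHull_min (t := {B | cycleFunctional a B ≤ n - 2 + 2 * (1 - α) * ε}) ?_ ?_
    (W.apply_mem_convexHull _)
  · rintro _ ⟨D, rfl⟩
    have h0 : 0 ≤ 2 * (1 - α) * ε := by
      have : 0 ≤ 1 - α := by linarith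
      positivity
    rcases detWiring_apply_familyBehavior hn D ha hBt hα0 hα1 hε0 hε1 with h | ⟨h, -⟩
    · exact h.trans (by linarith)
    · exact h
  · intro p hp q hq b c hb hc hbc
    simp only [Set.mem_ofPred_eq] at *
    rw [cycleFunctional_combination]
    have h1 := add_le_add (mul_le_mul_of_nonneg_left hp hb) (mul_le_mul_of_nonneg_left hq hc)
    rwa [← add_mul, hbc, one_mul] at h1

/-- A violation of the inequality can be kept only together with a proportional amount of white
noise, which contributes to the probability of every joint outcome. -/
theorem violation_le_of_wiring (hn : 3 ≤ n) (W : Wiring (cycleScenario n) (cycleScenario n))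
    {a : ZMod n → ℤ} (ha : OddSigns a) {Bt : (cycleScenario n).Table}
    (hBt : Bt ∈ (cycleScenario n).NC) {α ε : ℝ} (hα0 : 0 ≤ α) (hα1 : α ≤ 1) (hε0 : 0 ≤ ε)
    (hε1 : ε ≤ 1) (i : ZMod n) (s : (cycleScenario n).Outcome (edge i).1) :
    (1 - ε) * (cycleFunctional a (W.apply (familyBehavior (signBox a) Bt α ε)) - (n - 2)) ≤
      4 * n * ε * W.apply (familyBehavior (signBox a) Bt α ε) (edge i) s := by
  have hn0 : (n : ℝ) ≠ 0 := Nat.cast_ne_zero.2 (NeZero.ne n)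
  have hε : 0 ≤ 1 - ε := by linarith
  have hnε : 0 ≤ 4 * n * ε := by positivity
  refine convexHull_min
    (t := {B | (1 - ε) * (cycleFunctional a B - (n - 2)) ≤ 4 * n * ε * B (edge i) s}) ?_ ?_
    (W.apply_mem_convexHull _)
  · rintro _ ⟨D, rfl⟩
    have hB := D.apply_mem_behaviors (familyBehavior_mem_ND hn ha hBt hα0 hα1 hε0 hε1).1
    simp only [Set.mem_ofPred_eq]
    rcases detWiring_apply_familyBehavior hn D ha hBt hα0 hα1 hε0 hε1 with h | ⟨h, h'⟩
    · have h1 := mul_nonneg hnε ((hB (edge i)).1 s)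
      have h2 := mul_nonneg hε (sub_nonneg.2 h)
      linarith
    · have h1 := mul_le_mul_of_nonneg_left (h' i s) hnε
      have h2 := mul_le_mul_of_nonneg_left h hε
      have h3 : 4 * n * ε * ((1 - α) * (1 - ε) / (2 * n)) = (1 - ε) * (2 * (1 - α) * ε) := by
        field_simp
        ring
      linarith
  · intro p hp q hq b c hb hc hbc
    simp only [Set.mem_ofPred_eq, Pi.add_apply, Pi.smul_apply, smul_eq_mul] at *
    rw [cycleFunctional_combination]
    have h1 := add_le_add (mul_le_mul_of_nonneg_left hp hb) (mul_le_mul_of_nonneg_left hq hc)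
    have h2 : b = 1 - c := by linarith
    subst h2
    linarith

/-- Some joint outcome of `x_0` and `x_1` is impossible both in the contextual vertex and in the
deterministic behavior, so that its probability is due to the white noise alone. -/
theorem exists_familyBehavior_edge_eq (hn : 3 ≤ n) {a : ZMod n → ℤ} (ha : OddSigns a)
    (σ : ZMod n → Bool) :
    ∃ s, ∀ α ε, familyBehavior (signBox a) (detBox σ) α ε (edge 0) s =
      (1 - α) * (1 - ε) / (2 * n) := by
  have hn0 : (n : ℝ) ≠ 0 := Nat.cast_ne_zero.2 (NeZero.ne n)
  obtain ⟨b, hb⟩ : ∃ b, sgn (!σ 0) * sgn b ≠ a 0 := by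
    rcases ha.1 0 with h | h
    · exact ⟨σ 0, by rw [h]; cases σ 0 <;> decide⟩
    · exact ⟨!σ 0, by rw [h]; cases σ 0 <;> decide⟩
  refine ⟨edgeOutcome 0 (!σ 0) b, fun α ε => ?_⟩
  unfold familyBehavior
  rw [segmentBehavior_eq]
  simp only [Pi.add_apply, Pi.smul_apply, smul_eq_mul]
  rw [uniform_edge hn, signBox_edge hn, detBox_edge, left_edgeOutcome, right_edgeOutcome hn,
    if_neg hb, if_neg fun h => by simp at h]
  field_simp
  ring

/-! ### Conversions within the family -/

section Convert

variable {a : ZMod n → ℤ} {Bt : (cycleScenario n).Table} {A B : (cycleScenario n).ND}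
  {α ε α' ε' : ℝ}

/-- The target violates the inequality more strongly than the given behavior. -/
theorem not_convert_of_violation_lt (hn : 3 ≤ n) (ha : OddSigns a) (hBt : Bt ∈ saturatingVertices a)
    (hA : (A : (cycleScenario n).Table) = familyBehavior (signBox a) Bt α ε)
    (hB : (B : (cycleScenario n).Table) = familyBehavior (signBox a) Bt α' ε')
    (hα0 : 0 ≤ α) (hα1 : α ≤ 1) (hε0 : 0 ≤ ε) (hε1 : ε ≤ 1)
    (hlt : (1 - α) * ε < (1 - α') * ε') :
    ¬ NCWConverts ⟨cycleScenario n, A⟩ ⟨cycleScenario n, B⟩ := by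
  rintro ⟨W, hW⟩
  have h := cycleFunctional_wiring_le hn W ha hBt.1.1 hα0 hα1 hε0 hε1
  dsimp only at hW
  rw [← hA, hW, hB, cycleFunctional_familyBehavior hn ha hBt.2] at h
  linarith

/-- The given behavior carries too much white noise relative to its violation. -/
theorem not_convert_of_parameter_lt (hn : 3 ≤ n) (ha : OddSigns a) (hBt : Bt ∈ saturatingVertices a)
    (hA : (A : (cycleScenario n).Table) = familyBehavior (signBox a) Bt α ε)
    (hB : (B : (cycleScenario n).Table) = familyBehavior (signBox a) Bt α' ε')
    (hα0 : 0 ≤ α) (hα1 : α ≤ 1) (hε0 : 0 ≤ ε) (hε1 : ε ≤ 1) (hα' : α' < 1) (hlt : ε < ε') :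
    ¬ NCWConverts ⟨cycleScenario n, A⟩ ⟨cycleScenario n, B⟩ := by
  rintro ⟨W, hW⟩
  have hn0 : (n : ℝ) ≠ 0 := Nat.cast_ne_zero.2 (NeZero.ne n)
  obtain ⟨σ, hσ⟩ := extremePoints_NC_subset hBt.1
  have hσ' : detBox σ = Bt := hσ
  obtain ⟨s, hs⟩ := exists_familyBehavior_edge_eq hn ha σ
  rw [hσ'] at hs
  have h := violation_le_of_wiring hn W ha hBt.1.1 hα0 hα1 hε0 hε1 0 s
  dsimp only at hW
  rw [← hA, hW, hB, cycleFunctional_familyBehavior hn ha hBt.2, hs] at h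
  have h1 : 4 * n * ε * ((1 - α') * (1 - ε') / (2 * n)) = 2 * (1 - α') * (ε * (1 - ε')) := by
    field_simp
    ring
  rw [h1] at h
  have h2 : 0 < (1 - α') * (ε' - ε) := mul_pos (by linarith) (by linarith)
  linarith

theorem familyBehavior_convert (hBt : Bt ∈ saturatingVertices a) {Bk : (cycleScenario n).Table}
    (hA : (A : (cycleScenario n).Table) = familyBehavior Bk Bt α ε)
    (hB : (B : (cycleScenario n).Table) = familyBehavior Bk Bt α' ε)
    (hα : α ≤ α') (hα1 : α < 1) (hα' : α' ≤ 1) :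
    NCWConverts ⟨cycleScenario n, A⟩ ⟨cycleScenario n, B⟩ := by
  obtain ⟨t, ht⟩ := extremePoints_NC_subset hBt.1
  have h0 : 0 < 1 - α := by linarith
  refine NCWConverts.mix_deterministic A B t ((1 - α') / (1 - α))
    (div_nonneg (by linarith) h0.le) ((div_le_one h0).2 (by linarith)) ?_
  rw [hA, hB, ht]
  unfold familyBehavior
  have h1 : 1 - α' = (1 - α') / (1 - α) * (1 - α) := by field_simp
  have h2 : α' = 1 - (1 - α') / (1 - α) * (1 - α) := by linarith
  generalize (1 - α') / (1 - α) = w at *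
  subst h2
  module

theorem ne_of_parameters_ne (hn : 3 ≤ n) (ha : OddSigns a) (hBt : Bt ∈ saturatingVertices a)
    (hA : (A : (cycleScenario n).Table) = familyBehavior (signBox a) Bt α ε)
    (hB : (B : (cycleScenario n).Table) = familyBehavior (signBox a) Bt α' ε')
    (h : (1 - α) * ε ≠ (1 - α') * ε') : A ≠ B := by
  rintro rfl
  have h1 := cycleFunctional_familyBehavior hn ha hBt.2 α ε
  rw [← hA, hB, cycleFunctional_familyBehavior hn ha hBt.2] at h1
  exact h (by linarith)

end Convert

theorem exists_triple (hn : 3 ≤ n) {a : ZMod n → ℤ} (ha : OddSigns a)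
    {Bk Bt : (cycleScenario n).Table} (hBk : Bk ∈ NDC n) (hI : cycleFunctional a Bk = n)
    (hBt : Bt ∈ saturatingVertices a) :
    ∃ B₁ B₂ B₃ : (cycleScenario n).ND,
      (B₁ : (cycleScenario n).Table) = familyBehavior Bk Bt (1 / 4) (1 / 4) ∧
      (B₂ : (cycleScenario n).Table) = familyBehavior Bk Bt (3 / 4) (1 / 2) ∧
      (B₃ : (cycleScenario n).Table) = familyBehavior Bk Bt (1 / 8) (1 / 4) ∧
      B₁ ≠ B₂ ∧ B₂ ≠ B₃ ∧ B₁ ≠ B₃ ∧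
      Incomparable NCWConverts (⟨cycleScenario n, B₁⟩ : Obj) ⟨cycleScenario n, B₂⟩ ∧
      Incomparable NCWConverts (⟨cycleScenario n, B₂⟩ : Obj) ⟨cycleScenario n, B₃⟩ ∧
      NCWConverts ⟨cycleScenario n, B₃⟩ ⟨cycleScenario n, B₁⟩ := by
  obtain rfl := eq_signBox hn ha hBk.1.1 hI
  have hmem : ∀ {α ε : ℝ}, 0 ≤ α → α ≤ 1 → 0 ≤ ε → ε ≤ 1 →
      familyBehavior (signBox a) Bt α ε ∈ (cycleScenario n).ND :=
    familyBehavior_mem_ND hn ha hBt.1.1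
  refine ⟨⟨_, hmem (α := 1 / 4) (ε := 1 / 4) ?_ ?_ ?_ ?_⟩,
    ⟨_, hmem (α := 3 / 4) (ε := 1 / 2) ?_ ?_ ?_ ?_⟩,
    ⟨_, hmem (α := 1 / 8) (ε := 1 / 4) ?_ ?_ ?_ ?_⟩, rfl, rfl, rfl,
    ne_of_parameters_ne hn ha hBt rfl rfl ?_, ne_of_parameters_ne hn ha hBt rfl rfl ?_,
    ne_of_parameters_ne hn ha hBt rfl rfl ?_,
    ⟨not_convert_of_parameter_lt hn ha hBt rfl rfl ?_ ?_ ?_ ?_ ?_ ?_,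
      not_convert_of_violation_lt hn ha hBt rfl rfl ?_ ?_ ?_ ?_ ?_⟩,
    ⟨not_convert_of_violation_lt hn ha hBt rfl rfl ?_ ?_ ?_ ?_ ?_,
      not_convert_of_parameter_lt hn ha hBt rfl rfl ?_ ?_ ?_ ?_ ?_ ?_⟩,
    familyBehavior_convert hBt rfl rfl ?_ ?_ ?_⟩
  all_goals norm_num

end Cycle

open Cycle in
theorem mainTheorem6 :
    ¬ IsWeak NCWConverts ∧
    ∀ (n : ℕ) [NeZero n], 3 ≤ n → ∀ a : ZMod n → ℤ, OddSigns a →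
      (∃! Bk : (cycleScenario n).Table, Bk ∈ NDC n ∧ cycleFunctional a Bk = n) ∧
      (saturatingVertices a).Nonempty ∧
      ∀ Bk ∈ NDC n, cycleFunctional a Bk = n → ∀ Bt ∈ saturatingVertices a,
        ∃ B₁ B₂ B₃ : (cycleScenario n).ND,
          (B₁ : (cycleScenario n).Table) = familyBehavior Bk Bt (1 / 4) (1 / 4) ∧
          (B₂ : (cycleScenario n).Table) = familyBehavior Bk Bt (3 / 4) (1 / 2) ∧
          (B₃ : (cycleScenario n).Table) = familyBehavior Bk Bt (1 / 8) (1 / 4) ∧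
          B₁ ≠ B₂ ∧ B₂ ≠ B₃ ∧ B₁ ≠ B₃ ∧
          Incomparable NCWConverts (⟨cycleScenario n, B₁⟩ : Obj) ⟨cycleScenario n, B₂⟩ ∧
          Incomparable NCWConverts (⟨cycleScenario n, B₂⟩ : Obj) ⟨cycleScenario n, B₃⟩ ∧
          NCWConverts ⟨cycleScenario n, B₃⟩ ⟨cycleScenario n, B₁⟩ := by
  refine ⟨fun hweak => ?_, fun n _ hn a ha => ⟨⟨signBox a, ⟨signBox_mem_NDC hn ha,
    cycleFunctional_signBox_self hn ha.1⟩, fun B hB => eq_signBox hn ha hB.1.1.1 hB.2⟩,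
    saturatingVertices_nonempty hn ha, fun Bk hBk hI Bt hBt => exists_triple hn ha hBk hI hBt⟩⟩
  have ha : OddSigns (n := 3) fun _ => -1 :=
    ⟨fun _ => Or.inr rfl, by simp [ZMod.card]; decide⟩
  obtain ⟨Bt, hBt⟩ := saturatingVertices_nonempty le_rfl ha
  obtain ⟨B₁, B₂, B₃, -, -, -, h12, h23, h13, hi12, hi23, h31⟩ :=
    exists_triple le_rfl ha (signBox_mem_NDC le_rfl ha)
      (cycleFunctional_signBox_self le_rfl ha.1) hBt
  exact (hweak ⟨_, B₁⟩ ⟨_, B₂⟩ ⟨_, B₃⟩ (by simpa using h12) (by simpa using h23)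
    (by simpa using h13) hi12 hi23).2 h31

end
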